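/- Let $m,n\ge 0$ be integers, $p=4m+1$ and $E=\{1,\dots,p\}$. For $i,j\in E$ put $(i|j)=1$ if $i<j$ and $(i|j)=-1$ if $j\le i$, and for $A,B\subset E$ put $(A|B)=\prod_{i\in A,\,j\in B}(i|j)$; these are the signs of the standard Clifford algebra $\mathcal{C}l(E)$ with basis $(\omega_A)_{A\subset E}$ and product $\omega_A\omega_B=(A|B)\,\omega_{A\Delta B}$. Consider the families $(M^A)_{A\subset E}$ of real $n\times n$ matrices with $(M^A)^t=(A|A)M^A$ for all $A$; each defines a real symmetric $n2^p\times n2^p$ matrix $\mathcal M$ with blocks $\mathcal M^{A,B}=(A\Delta B|B)\,M^{A\Delta B}$ (a $\mathcal{C}l(E)$-symmetric matrix). Let $L$ be the second order diffusion operator on functions of these matrices that is determined by $$L(M^A_{ij})=0,\qquad \Gamma(M^A_{ij},M^B_{kl})=\tfrac12\,\delta_{A,B}\big(\delta_{ik}\delta_{jl}+(A|A)\,\delta_{il}\delta_{jk}\big),$$ where $\Gamma(f,g)=\frac12\big(L(fg)-fL(g)-gL(f)\big)$ (the Euclidean Laplace operator). Let $P(X)=\det(\mathcal M-X\,\mathrm{Id})$;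 primes are derivatives in $X$. Then, at every $\mathcal{C}l(E)$-symmetric matrix: 1. For all real $X\ne Y$, $$\Gamma(P(X),P(Y))=\frac{2^p}{Y-X}\big(P'(X)P(Y)-P'(Y)P(X)\big).$$ 2. For all real $X$ with $P(X)\neq0$, $$\frac{L(P)}{P}=2^p\Big(\frac{P'^2}{P^2}-\frac{P''}{P}\Big)-\frac12\,\frac{P'^2}{P^2}.$$ 3. Let $a=2^{2m+1}$. There is a monic polynomial $Q(X)$ of degree $N=n2^{2m}$, whose coefficients are polynomials in the entries of the matrices $M^A$, such that $P=Q^a$; for each $\mathcal{C}l(E)$-symmetric matrix, $\pm Q$ are the only real polynomials in $X$ whose $a$-th power is $P$. For $\hat L=a2^{-p}L$, with carré du champ $\hat\Gamma$, one has $\hat L(Q)=-Q''$ and, for all real $X\neq Y$, $$\hat\Gamma(Q(X),Q(Y))=\frac{1}{Y-X}\big(Q'(X)Q(Y)-Q'(Y)Q(X)\big).$$ 4. This is the complex case: consider Hermitian $N\times N$ matrices $H=M+iA$ ($M$ real symmetric, $A$ real antisymmetric) with the diffusion operator $L_{\mathbb C}$ determined by $L_{\mathbb C}(M_{ij})=L_{\mathbb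 C}(A_{ij})=0$, $\Gamma_{\mathbb C}(M_{ij},M_{kl})=\frac12(\delta_{ik}\delta_{jl}+\delta_{il}\delta_{jk})$, $\Gamma_{\mathbb C}(A_{ij},A_{kl})=\frac12(\delta_{ik}\delta_{jl}-\delta_{il}\delta_{jk})$, $\Gamma_{\mathbb C}(M_{ij},A_{kl})=0$. The characteristic polynomial $P_1(X)=\det(X\,\mathrm{Id}-H)$, which is monic of degree $N$ with real coefficients, satisfies the same relations: $L_{\mathbb C}(P_1)=-P_1''$ and $\Gamma_{\mathbb C}(P_1(X),P_1(Y))=\frac{1}{Y-X}\big(P_1'(X)P_1(Y)-P_1'(Y)P_1(X)\big)$ for all real $X\ne Y$. -/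

import Mathlib

/-! ### Diffusion operators with constant coefficients -/

section Diffusion

variable {ι : Type*} [Fintype ι] [DecidableEq ι]

/-- The partial derivative of `f : ℝ^ι → ℝ` along the coordinate `a`. -/
noncomputable def coordDeriv (a : ι) (f : (ι → ℝ) → ℝ) : (ι → ℝ) → ℝ :=
  fun x => lineDeriv ℝ f x (Pi.single a 1)

/-- The diffusion operator `L` on functions on `ℝ^ι` that is determined, through the change of
variables formula, by `Γ(x_a, x_b) = g a b` and `L(x_a) = 0` for the coordinate functions:
`L f = ∑_{a,b} g a b ∂_a ∂_b f`. -/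
noncomputable def diffusionOp (g : ι → ι → ℝ) (f : (ι → ℝ) → ℝ) : (ι → ℝ) → ℝ :=
  fun x => ∑ a, ∑ b, g a b * coordDeriv a (coordDeriv b f) x

/-- The carré du champ `Γ(f, h) = (L(fh) - f L(h) - h L(f)) / 2` of an operator `L`. -/
noncomputable def carreDuChamp {E : Type*} (L : (E → ℝ) → E → ℝ) (f h : E → ℝ) : E → ℝ :=
  fun x => (1 / 2) * (L (fun y => f y * h y) x - f x * L h x - h x * L f x)

end Diffusion

/-! ### The standard Clifford algebra with `p` generators: signs and symmetric matrices -/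

/-- `(i|j) = 1` if `i < j` and `(i|j) = -1` if `j ≤ i`. -/
def genSign {p : ℕ} (i j : Fin p) : ℝ := if i < j then 1 else -1

/-- `(A|B) = ∏_{i ∈ A, j ∈ B} (i|j)`, so that `ω_A ω_B = (A|B) ω_{A ∆ B}`. -/
def cliffordSign {p : ℕ} (A B : Finset (Fin p)) : ℝ := ∏ i ∈ A, ∏ j ∈ B, genSign i j

/-- Index set of the entries `M^A_{ij}` of a family `(M^A)_{A ⊆ E}` of real `n × n` matrices,
with `E = Fin p`. -/
abbrev CliffordIdx (p n : ℕ) : Type := Finset (Fin p) × Fin n × Fin n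

/-- The matrix `M^A` of the family with entries `x`. -/
def cliffordComponent {p n : ℕ} (x : CliffordIdx p n → ℝ) (A : Finset (Fin p)) :
    Matrix (Fin n) (Fin n) ℝ :=
  Matrix.of fun i j => x (A, i, j)

/-- The families with `(M^A)ᵗ = (A|A) M^A` for all `A`. -/
def cliffordSymmetric (p n : ℕ) : Set (CliffordIdx p n → ℝ) :=
  {x | ∀ A, (cliffordComponent x A).transpose = cliffordSign A A • cliffordComponent x A}

/-- The real block matrix with blocks `(A ∆ B|B) M^{A ∆ B}`, which is the matrix of the left
multiplication by `∑_A M^A ω_A` on `ℝ^n ⊗ Cl(E)` in the basis `(ω_A)`. -/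
def cliffordBlock {p n : ℕ} (x : CliffordIdx p n → ℝ) :
    Matrix (Finset (Fin p) × Fin n) (Finset (Fin p) × Fin n) ℝ :=
  Matrix.of fun r c =>
    cliffordSign (symmDiff r.1 c.1) c.1 * cliffordComponent x (symmDiff r.1 c.1) r.2 c.2

/-- `P(X) = det(𝓜 - X Id)`, as a polynomial in `X`. -/
noncomputable def cliffordPoly {p n : ℕ} (x : CliffordIdx p n → ℝ) : Polynomial ℝ :=
  ((cliffordBlock x).map Polynomial.C - Matrix.scalar _ Polynomial.X).det

/-- `Γ(M^A_{ij}, M^B_{kl}) = ½ δ_{AB} (δ_{ik} δ_{jl} + (A|A) δ_{il} δ_{jk})`. -/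
noncomputable def cliffordMetric {p n : ℕ} (a b : CliffordIdx p n) : ℝ :=
  if a.1 = b.1 then
    (1 / 2) * ((if a.2.1 = b.2.1 ∧ a.2.2 = b.2.2 then 1 else 0)
      + cliffordSign a.1 a.1 * (if a.2.1 = b.2.2 ∧ a.2.2 = b.2.1 then 1 else 0))
  else 0

/-- The Euclidean Laplace operator of the Clifford-symmetric matrices. The form
`cliffordMetric` is the orthogonal projection onto `cliffordSymmetric`, so at a point of this
subspace `L f` depends only on the restriction of `f` to it. -/
noncomputable def cliffordLaplacian (p n : ℕ) :
    ((CliffordIdx p n → ℝ) → ℝ) → (CliffordIdx p n → ℝ) → ℝ :=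
  diffusionOp cliffordMetric

/-- The value at the family `x` of a polynomial in `X` whose coefficients are polynomials in the
entries of the family. -/
noncomputable def specializeAt {ι : Type*} (Q : Polynomial (MvPolynomial ι ℝ)) (x : ι → ℝ) :
    Polynomial ℝ :=
  Q.map (MvPolynomial.eval x)

/-! ### The complex case: Hermitian matrices -/

/-- Index set of the entries of a pair `(M, A)` of real `N × N` matrices. -/
abbrev HermitianIdx (N : ℕ) : Type := (Fin N × Fin N) ⊕ (Fin N × Fin N)

/-- The complex matrix `H = M + iA`. -/
noncomputable def hermitianMatrix {N : ℕ} (x : HermitianIdx N → ℝ) : Matrix (Fin N) (Fin N) ℂ :=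
  Matrix.of fun i j => (x (Sum.inl (i, j)) : ℂ) + (x (Sum.inr (i, j)) : ℂ) * Complex.I

/-- The characteristic polynomial `det(X Id - H)` as a real polynomial: if `H` is Hermitian, then
its coefficients are real. -/
noncomputable def hermitianPoly {N : ℕ} (x : HermitianIdx N → ℝ) : Polynomial ℝ :=
  ∑ k ∈ Finset.range (N + 1), Polynomial.monomial k ((hermitianMatrix x).charpoly.coeff k).re

/-- `Γ(M_{ij}, M_{kl}) = ½(δ_{ik} δ_{jl} + δ_{il} δ_{jk})`,
`Γ(A_{ij}, A_{kl}) = ½(δ_{ik} δ_{jl} - δ_{il} δ_{jk})`, `Γ(M_{ij}, A_{kl}) = 0`. -/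
noncomputable def hermitianMetric {N : ℕ} : HermitianIdx N → HermitianIdx N → ℝ
  | Sum.inl a, Sum.inl b => (1 / 2) * ((if a.1 = b.1 ∧ a.2 = b.2 then 1 else 0)
      + (if a.1 = b.2 ∧ a.2 = b.1 then 1 else 0))
  | Sum.inr a, Sum.inr b => (1 / 2) * ((if a.1 = b.1 ∧ a.2 = b.2 then 1 else 0)
      - (if a.1 = b.2 ∧ a.2 = b.1 then 1 else 0))
  | _, _ => 0

/-- The Euclidean Laplace operator of the Hermitian `N × N` matrices. -/
noncomputable def hermitianLaplacian (N : ℕ) :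
    ((HermitianIdx N → ℝ) → ℝ) → (HermitianIdx N → ℝ) → ℝ :=
  diffusionOp hermitianMetric

/-!
The formulas hold because the Clifford-symmetric matrices are, in disguise, Hermitian matrices of
size `N = n 2^(2m)` with the Euclidean metric, up to scale.

Let `H(x) = ∑ x_a e_a` be a linear family of complex `N × N` matrices, let `g` be an orthogonal
projection of the parameter space, and suppose that `∑ g a b (e_a ⊗ e_b)` is `c` times the flip of
`ℂ^N ⊗ ℂ^N` and that `H` is Hermitian on the image of `g` (`IsHermitianFamily`). Write `q` for the
characteristic polynomial of `H` and `R_X` for the resolvent. Jacobi's formula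
(`Derivation.map_det`) gives `∂_a q / q = -tr(R e_a)`, so contracting with the flip turns `Γ(q(X),
q(Y)) / q(X) q(Y)` into `c tr(R_X R_Y)`, which the resolvent identity evaluates
(`Matrix.trace_adjugate_mul_adjugate`). Likewise `L(q) / q = c (tr R² - (tr R)²) = -c q'' / q`
(`eval_polyDiffusion_pencilCharpoly`). Adjugates replace resolvents in the formal argument, so
that no matrix has to be invertible. As `L` and `Γ` at a point of the image of `g` only see
restrictions to that image (`IsProjectionForm.polyDiffusion_congr`), the polynomial `q` may be
replaced by its real part, which agrees with it there.

For Hermitian matrices the flip identity is immediate, with `c = 1`. For the Clifford algebra with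
`p = 4m+1` generators, take a complex `*`-representation `ω` of dimension `2^(2m)`, built from
Pauli matrices (`exists_clifford_generators`), and `e_(A,i,j) = E_ij ⊗ ω_A`. The `ω_A` are
orthogonal for the real part of the trace form, because all of them but the identity have a trace
with zero real part (`IsCliffordRep.re_trace_eq_zero`). There are `2^p = 2 (2^(2m))²` of them, the
real dimension of the matrix algebra, so orthogonality implies completeness
(`IsCliffordRep.conjTranspose_mul_cliffordEntries`), which is the flip identity with `c = 2^(2m)`.
The same square matrix of entries of the `ω_A` and their conjugates conjugates the block matrix
into `2^(2m)` copies of `H` and of its conjugate, so that `P = Q^a` with `a = 2^(2m+1)`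
(`IsCliffordRep.cliffordPoly_eq_pow`), and the formulas for `P` follow from those for `Q` by the
chain rule and `2^p = 2 c² = a c`.
-/

/-! ### Derivatives of determinants, and contractions with the flip -/

open Matrix in
/-- Jacobi's formula for a derivation of a commutative ring. -/
theorem Derivation.map_det {R S N : Type*} [CommRing R] [CommRing S] [Algebra R S]
    [Fintype N] [DecidableEq N] (D : Derivation R S S) (Z : Matrix N N S) :
    D Z.det = (Z.adjugate * Z.map D).trace := by
  have hprod : ∀ (s : Finset N) (f : N → S),
      D (∏ i ∈ s, f i) = ∑ i ∈ s, ∏ j ∈ s, if j = i then D (f j) else f j := by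
    intro s f
    induction s using Finset.induction_on with
    | empty => simp
    | insert a s ha ih =>
      rw [Finset.prod_insert ha, Derivation.leibniz, ih, Finset.sum_insert ha,
        Finset.prod_insert ha, smul_eq_mul, smul_eq_mul, add_comm, Finset.mul_sum]
      congr 1
      · rw [if_pos rfl, mul_comm]
        congr 1
        refine Finset.prod_congr rfl fun j hj => ?_
        rw [if_neg (by rintro rfl; exact ha hj)]
      · refine Finset.sum_congr rfl fun i hi => ?_
        rw [Finset.prod_insert ha, if_neg (by rintro rfl; exact ha hi)]
  have htr : (Z.adjugate * Z.map D).trace = ∑ i, (Z.updateCol i fun k => D (Z k i)).det := by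
    simp only [trace, diag_apply]
    refine Finset.sum_congr rfl fun i _ => ?_
    rw [← cramer_apply, cramer_eq_adjugate_mulVec]
    rfl
  rw [htr, det_apply, map_sum]
  simp only [det_apply]
  rw [Finset.sum_comm]
  refine Finset.sum_congr rfl fun σ _ => ?_
  rw [Units.smul_def, map_zsmul, hprod, Finset.smul_sum]
  refine Finset.sum_congr rfl fun i _ => ?_
  rw [Units.smul_def]
  congr 1
  refine Finset.prod_congr rfl fun j _ => ?_
  by_cases h : j = i
  · subst h; simp
  · simp [h]

open Matrix in
/-- Second derivatives of a determinant along directions in which the matrix is affine. Multiplying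
by `det Z` replaces `Z⁻¹` by the adjugate, so that the formula needs no invertibility. -/
theorem Derivation.det_mul_map_map_det {R S N : Type*} [CommRing R] [CommRing S] [Algebra R S]
    [Fintype N] [DecidableEq N] (D₁ D₂ : Derivation R S S) (Z : Matrix N N S)
    (hZ : (Z.map D₂).map D₁ = 0) :
    Z.det * D₁ (D₂ Z.det) =
      (Z.adjugate * Z.map D₁).trace * (Z.adjugate * Z.map D₂).trace
        - (Z.adjugate * Z.map D₁ * (Z.adjugate * Z.map D₂)).trace := by
  have hmul : ∀ U V : Matrix N N S, (U * V).map D₁ = U.map D₁ * V + U * V.map D₁ := by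
    intro U V
    ext i j
    rw [Matrix.add_apply, mul_apply, mul_apply, map_apply, mul_apply, map_sum,
      ← Finset.sum_add_distrib]
    refine Finset.sum_congr rfl fun k _ => ?_
    simp only [Matrix.map_apply, Derivation.leibniz, smul_eq_mul]
    ring
  have htr : ∀ U : Matrix N N S, D₁ U.trace = (U.map D₁).trace := by
    intro U; simp [trace]
  -- differentiating `adj Z * Z = det Z` and multiplying by `adj Z` on the right
  have hadj : Z.det • Z.adjugate.map D₁ =
      (Z.adjugate * Z.map D₁).trace • Z.adjugate - Z.adjugate * Z.map D₁ * Z.adjugate := by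
    have h1 := congrArg (fun U : Matrix N N S => U.map D₁) (adjugate_mul Z)
    have h2 : (Z.det • (1 : Matrix N N S)).map D₁ = D₁ Z.det • (1 : Matrix N N S) := by
      ext i j
      by_cases h : i = j <;> simp [h]
    simp only [hmul, h2] at h1
    have h3 := congrArg (fun U : Matrix N N S => U * Z.adjugate) h1
    simp only [add_mul, Matrix.mul_assoc, mul_adjugate] at h3
    rw [Derivation.map_det] at h3
    simp only [Matrix.mul_smul, Matrix.mul_one, Matrix.smul_mul, Matrix.one_mul] at h3
    rw [eq_sub_iff_add_eq, Matrix.mul_assoc]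
    exact h3
  rw [Derivation.map_det D₂, htr, hmul, hZ, Matrix.mul_zero, add_zero, ← smul_eq_mul,
    ← trace_smul, ← Matrix.smul_mul, hadj, Matrix.sub_mul, trace_sub, Matrix.smul_mul, trace_smul,
    smul_eq_mul]
  simp only [Matrix.mul_assoc]

section Casimir

open Matrix

variable {S N ι : Type*} [CommRing S] [Fintype N] [DecidableEq N] [Fintype ι]

/-- If `∑ g a b (e a ⊗ e b)` is `c` times the flip of `S^N ⊗ S^N`, then the contraction of this
tensor with any four-index array `w` is computed by identifying the crossed indices. -/
theorem sum_mul_sum_eq_of_casimir (g : ι → ι → S) (e : ι → Matrix N N S) (c : S)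
    (hc : ∀ i j k l, ∑ a, ∑ b, g a b * (e a i j * e b k l) = if i = l ∧ j = k then c else 0)
    (w : N → N → N → N → S) :
    ∑ a, ∑ b, g a b * ∑ i, ∑ j, ∑ k, ∑ l, w i j k l * (e a i j * e b k l) =
      c * ∑ i, ∑ j, w i j j i := by
  have h : ∀ (a b : ι), g a b * ∑ i, ∑ j, ∑ k, ∑ l, w i j k l * (e a i j * e b k l) =
      ∑ r : N × N × N × N, w r.1 r.2.1 r.2.2.1 r.2.2.2 *
        (g a b * (e a r.1 r.2.1 * e b r.2.2.1 r.2.2.2)) := by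
    intro a b
    simp only [Fintype.sum_prod_type, Finset.mul_sum]
    refine Finset.sum_congr rfl fun i _ => Finset.sum_congr rfl fun j _ =>
      Finset.sum_congr rfl fun k _ => Finset.sum_congr rfl fun l _ => ?_
    ring
  simp only [h]
  simp_rw [Finset.sum_comm (s := Finset.univ (α := ι)) (t := Finset.univ (α := N × N × N × N)),
    ← Finset.mul_sum, hc, Fintype.sum_prod_type, Finset.mul_sum]
  refine Finset.sum_congr rfl fun i _ => Finset.sum_congr rfl fun j _ => ?_
  rw [Finset.sum_eq_single j, Finset.sum_eq_single i]
  · simp [mul_comm]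
  · intro l _ hl; simp [hl.symm]
  · simp
  · intro k _ hk; simp [hk.symm]
  · simp

theorem sum_trace_mul_trace_of_casimir (g : ι → ι → S) (e : ι → Matrix N N S) (c : S)
    (hc : ∀ i j k l, ∑ a, ∑ b, g a b * (e a i j * e b k l) = if i = l ∧ j = k then c else 0)
    (U V : Matrix N N S) :
    ∑ a, ∑ b, g a b * ((U * e a).trace * (V * e b).trace) = c * (U * V).trace := by
  have h : ∀ a b, (U * e a).trace * (V * e b).trace =
      ∑ i, ∑ j, ∑ k, ∑ l, U j i * V l k * (e a i j * e b k l) := by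
    intro a b
    have ht : ∀ A B : Matrix N N S, (A * B).trace = ∑ i, ∑ j, A j i * B i j := by
      intro A B
      rw [trace_mul_comm]
      simp only [trace, diag_apply, mul_apply, mul_comm]
    simp only [ht, Finset.sum_mul]
    simp only [Finset.mul_sum]
    refine Finset.sum_congr rfl fun i _ => Finset.sum_congr rfl fun j _ =>
      Finset.sum_congr rfl fun k _ => Finset.sum_congr rfl fun l _ => ?_
    ring
  simp only [h]
  rw [sum_mul_sum_eq_of_casimir g e c hc, trace_mul_comm]
  simp only [trace, diag_apply, mul_apply, mul_comm]

theorem sum_trace_mul_mul_mul_of_casimir (g : ι → ι → S) (e : ι → Matrix N N S) (c : S)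
    (hc : ∀ i j k l, ∑ a, ∑ b, g a b * (e a i j * e b k l) = if i = l ∧ j = k then c else 0)
    (U V : Matrix N N S) :
    ∑ a, ∑ b, g a b * (U * e a * (V * e b)).trace = c * (U.trace * V.trace) := by
  have h : ∀ a b, (U * e a * (V * e b)).trace =
      ∑ i, ∑ j, ∑ k, ∑ l, U l i * V j k * (e a i j * e b k l) := by
    intro a b
    rw [Matrix.mul_assoc, trace_mul_comm, Matrix.mul_assoc, Matrix.mul_assoc]
    simp only [trace, diag_apply, mul_apply, Finset.mul_sum]
    refine Finset.sum_congr rfl fun i _ => Finset.sum_congr rfl fun j _ =>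
      Finset.sum_congr rfl fun k _ => Finset.sum_congr rfl fun l _ => ?_
    ring
  simp only [h]
  rw [sum_mul_sum_eq_of_casimir g e c hc]
  simp only [trace, diag_apply, Finset.sum_mul_sum]

end Casimir

/-! ### Constant coefficient diffusion operators on polynomials -/

theorem carreDuChamp_const_mul {E : Type*} (k : ℝ) (L : (E → ℝ) → E → ℝ) (f h : E → ℝ) (x : E) :
    carreDuChamp (fun f y => k * L f y) f h x = k * carreDuChamp L f h x := by
  simp only [carreDuChamp]
  ring

section PolyDiffusion

open MvPolynomial

variable {ι K : Type*} [Fintype ι] [CommRing K]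

/-- The operator `∑_{a,b} g a b ∂_a ∂_b` on polynomials. -/
noncomputable def polyDiffusion (g : ι → ι → K) : MvPolynomial ι K →ₗ[K] MvPolynomial ι K :=
  ∑ a, ∑ b, g a b • (pderiv a).toLinearMap ∘ₗ (pderiv b).toLinearMap

theorem eval_polyDiffusion (g : ι → ι → K) (f : MvPolynomial ι K) (x : ι → K) :
    eval x (polyDiffusion g f) = ∑ a, ∑ b, g a b * eval x (pderiv a (pderiv b f)) := by
  simp [polyDiffusion, LinearMap.sum_apply]

theorem eval_map_polyDiffusion {K' : Type*} [CommRing K'] (φ : K →+* K') (g : ι → ι → K)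
    (f : MvPolynomial ι K) :
    polyDiffusion (fun a b => φ (g a b)) (map φ f) = map φ (polyDiffusion g f) := by
  simp [polyDiffusion, LinearMap.sum_apply, pderiv_map, MvPolynomial.smul_eq_C_mul]

variable [DecidableEq ι]

/-- The derivative of a polynomial function along a line. -/
theorem hasDerivAt_eval_add_smul (f : MvPolynomial ι ℝ) (x v : ι → ℝ) :
    HasDerivAt (fun t : ℝ => eval (x + t • v) f) (∑ a, v a * eval x (pderiv a f)) 0 := by
  induction f using MvPolynomial.induction_on with
  | C c => simpa using hasDerivAt_const (0 : ℝ) c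
  | add f h hf hh =>
    simpa [mul_add, Finset.sum_add_distrib] using hf.fun_add hh
  | mul_X f i hf =>
    have hX : HasDerivAt (fun t : ℝ => x i + t * v i) (v i) 0 := by
      simpa using ((hasDerivAt_id (0 : ℝ)).mul_const (v i)).const_add (x i)
    have h := hf.fun_mul hX
    have hs : (∑ a, v a * eval x (pderiv a f)) * (x i + 0 * v i) + eval (x + (0 : ℝ) • v) f * v i =
        ∑ a, v a * eval x (pderiv a (f * X i)) := by
      simp only [Derivation.leibniz, pderiv_X, smul_eq_mul, map_add, map_mul, eval_X, mul_add,
        Finset.sum_add_distrib, zero_mul, add_zero, zero_smul, Pi.single_apply]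
      rw [add_comm, Finset.sum_mul]
      congr 1
      · simp [mul_comm, apply_ite]
      · exact Finset.sum_congr rfl fun a _ => by ring
    rw [hs] at h
    simpa using h

theorem coordDeriv_eval (a : ι) (f : MvPolynomial ι ℝ) :
    coordDeriv a (fun y => eval y f) = fun y => eval y (pderiv a f) := by
  funext x
  rw [coordDeriv, lineDeriv, (hasDerivAt_eval_add_smul f x (Pi.single a 1)).deriv]
  simp [Pi.single_apply]

theorem diffusionOp_eval (g : ι → ι → ℝ) (f : MvPolynomial ι ℝ) (x : ι → ℝ) :
    diffusionOp g (fun y => eval y f) x = eval x (polyDiffusion g f) := by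
  simp [diffusionOp, coordDeriv_eval, eval_polyDiffusion]

theorem carreDuChamp_diffusionOp_eval (g : ι → ι → ℝ) (hg : ∀ a b, g a b = g b a)
    (f h : MvPolynomial ι ℝ) (x : ι → ℝ) :
    carreDuChamp (diffusionOp g) (fun y => eval y f) (fun y => eval y h) x =
      ∑ a, ∑ b, g a b * (eval x (pderiv a f) * eval x (pderiv b h)) := by
  have h1 : (fun y => eval y f * eval y h) = fun y => eval y (f * h) := by simp
  rw [carreDuChamp, h1, diffusionOp_eval, diffusionOp_eval, diffusionOp_eval]
  simp only [eval_polyDiffusion]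
  have h2 : ∑ a, ∑ b, g a b * (eval x (pderiv b f) * eval x (pderiv a h)) =
      ∑ a, ∑ b, g a b * (eval x (pderiv a f) * eval x (pderiv b h)) := by
    rw [Finset.sum_comm]
    exact Finset.sum_congr rfl fun a _ => Finset.sum_congr rfl fun b _ => by rw [hg]
  have h3 : ∑ a, ∑ b, g a b * eval x (pderiv a (pderiv b (f * h))) =
      eval x f * ∑ a, ∑ b, g a b * eval x (pderiv a (pderiv b h))
      + eval x h * ∑ a, ∑ b, g a b * eval x (pderiv a (pderiv b f))
      + ∑ a, ∑ b, g a b * (eval x (pderiv b f) * eval x (pderiv a h))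
      + ∑ a, ∑ b, g a b * (eval x (pderiv a f) * eval x (pderiv b h)) := by
    simp only [Finset.mul_sum, ← Finset.sum_add_distrib]
    refine Finset.sum_congr rfl fun a _ => Finset.sum_congr rfl fun b _ => ?_
    simp only [Derivation.leibniz, map_add, map_mul, smul_eq_mul]
    ring
  rw [h3, h2]
  ring

/-- `g` is the matrix of an orthogonal projection. -/
structure IsProjectionForm (g : ι → ι → ℝ) : Prop where
  symm : ∀ a b, g a b = g b a
  idem : ∀ a b, ∑ c, g a c * g c b = g a b

/-- The image of the projection with matrix `g`. -/
def fixedPoints (g : ι → ι → ℝ) : Set (ι → ℝ) := {x | ∀ a, ∑ b, g a b * x b = x a}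

/-- A polynomial that vanishes on the image of a projection has vanishing derivatives along it. -/
theorem IsProjectionForm.sum_pderiv_eq_zero {g : ι → ι → ℝ} (hg : IsProjectionForm g)
    {f : MvPolynomial ι ℝ} (hf : ∀ x ∈ fixedPoints g, eval x f = 0) {x : ι → ℝ}
    (hx : x ∈ fixedPoints g) (a : ι) : ∑ b, g a b * eval x (pderiv b f) = 0 := by
  have h0 : (fun t : ℝ => eval (x + t • g a) f) = fun _ => 0 := by
    funext t
    refine hf _ fun c => ?_
    simp only [Pi.add_apply, Pi.smul_apply, smul_eq_mul, mul_add, Finset.sum_add_distrib]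
    rw [hx c]
    congr 1
    rw [hg.symm a c, ← hg.idem c a, Finset.mul_sum]
    exact Finset.sum_congr rfl fun b _ => by rw [hg.symm a b]; ring
  have h1 := hasDerivAt_eval_add_smul f x (g a)
  rw [h0] at h1
  exact h1.unique (hasDerivAt_const _ _)

/-- A polynomial that vanishes on the image of a projection is also annihilated there by the second
order operator of the projection. -/
theorem IsProjectionForm.polyDiffusion_eq_zero {g : ι → ι → ℝ} (hg : IsProjectionForm g)
    {f : MvPolynomial ι ℝ} (hf : ∀ x ∈ fixedPoints g, eval x f = 0) {x : ι → ℝ}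
    (hx : x ∈ fixedPoints g) : eval x (polyDiffusion g f) = 0 := by
  -- the derivatives `∑ b, g c b ∂_b f` along the image vanish there, so the first order statement
  -- applies to them
  have h1 : ∀ c, ∑ a, g c a * eval x (pderiv a (∑ b, C (g c b) * pderiv b f)) = 0 := fun c =>
    hg.sum_pderiv_eq_zero (fun y hy => by simpa using hg.sum_pderiv_eq_zero hf hy c) hx c
  have h2 : eval x (polyDiffusion g f) =
      ∑ c, ∑ a, g c a * eval x (pderiv a (∑ b, C (g c b) * pderiv b f)) := by
    rw [eval_polyDiffusion]
    simp only [map_sum, pderiv_C_mul, map_mul, eval_C]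
    simp_rw [Finset.mul_sum]
    rw [Finset.sum_comm]
    conv_rhs => rw [Finset.sum_comm]; enter [2, a]; rw [Finset.sum_comm]
    rw [Finset.sum_comm]
    refine Finset.sum_congr rfl fun a _ => Finset.sum_congr rfl fun b _ => ?_
    rw [← hg.idem a b, Finset.sum_mul]
    exact Finset.sum_congr rfl fun c _ => by rw [hg.symm a c]; ring
  rw [h2]
  exact Finset.sum_eq_zero fun c _ => h1 c

/-- At a point of the image of the projection `g`, the operator only depends on the restriction of
the polynomial to that image. -/
theorem IsProjectionForm.polyDiffusion_congr {g : ι → ι → ℝ} (hg : IsProjectionForm g)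
    {f h : MvPolynomial ι ℝ} (hf : ∀ x ∈ fixedPoints g, eval x f = eval x h) {x : ι → ℝ}
    (hx : x ∈ fixedPoints g) : eval x (polyDiffusion g f) = eval x (polyDiffusion g h) := by
  rw [← sub_eq_zero, ← map_sub, ← map_sub]
  exact hg.polyDiffusion_eq_zero (fun y hy => by simp [hf y hy]) hx

end PolyDiffusion

/-! ### Characteristic polynomials of linear families of matrices -/

section LinearFamily

open Matrix

theorem RingHom.map_trace_adjugate_mul {N S T : Type*} [Fintype N] [DecidableEq N] [CommRing S]
    [CommRing T] (φ : S →+* T) (Z Y : Matrix N N S) :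
    φ (adjugate Z * Y).trace = (adjugate (Z.map φ) * Y.map φ).trace := by
  have h := φ.map_adjugate Z
  simp only [RingHom.mapMatrix_apply] at h
  rw [← h, ← Matrix.map_mul, Matrix.trace, Matrix.trace, map_sum]
  rfl

theorem charmatrix_map_derivative {N K : Type*} [Fintype N] [DecidableEq N] [CommRing K]
    (H : Matrix N N K) : (charmatrix H).map (Polynomial.derivative' (R := K)) = 1 := by
  ext1 i j
  by_cases h : i = j
  · subst h; simp [charmatrix_apply_eq, Polynomial.derivative']
  · simp [Polynomial.derivative', h]

theorem charmatrix_map_eval {N K : Type*} [Fintype N] [DecidableEq N] [CommRing K]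
    (H : Matrix N N K) (z : K) :
    (charmatrix H).map (Polynomial.evalRingHom z) = scalar N z - H := by
  ext1 i j
  by_cases h : i = j
  · subst h; simp [charmatrix_apply_eq]
  · simp [h]

/-- The trace of `adj (z - H)` is the derivative of the characteristic polynomial of `H`. -/
theorem Matrix.trace_adjugate_scalar_sub {N K : Type*} [Fintype N] [DecidableEq N] [CommRing K]
    (H : Matrix N N K) (z : K) :
    (adjugate (scalar N z - H)).trace = H.charpoly.derivative.eval z := by
  have h := congrArg (Polynomial.evalRingHom z)
    (Derivation.map_det (Polynomial.derivative' (R := K)) (charmatrix H))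
  rw [charmatrix_map_derivative, RingHom.map_trace_adjugate_mul, charmatrix_map_eval] at h
  simpa [Matrix.charpoly] using h.symm

/-- In terms of the resolvent `R`, this says `q'' / q = (tr R)² - tr R²`. -/
theorem Matrix.eval_charpoly_mul_eval_derivative_derivative {N K : Type*} [Fintype N]
    [DecidableEq N] [CommRing K] (H : Matrix N N K) (z : K) :
    H.charpoly.eval z * H.charpoly.derivative.derivative.eval z =
      (adjugate (scalar N z - H)).trace ^ 2
        - (adjugate (scalar N z - H) * adjugate (scalar N z - H)).trace := by
  have hZ : ((charmatrix H).map (Polynomial.derivative' (R := K))).map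
      (Polynomial.derivative' (R := K)) = 0 := by
    rw [charmatrix_map_derivative]
    ext1 i j
    by_cases h : i = j <;> simp [h, Polynomial.derivative']
  have h := congrArg (Polynomial.evalRingHom z)
    (Derivation.det_mul_map_map_det _ _ (charmatrix H) hZ)
  rw [charmatrix_map_derivative, Matrix.mul_one, map_sub, map_mul, map_mul,
    ← Matrix.mul_one (adjugate (charmatrix H)), RingHom.map_trace_adjugate_mul,
    Matrix.mul_one, RingHom.map_trace_adjugate_mul, charmatrix_map_eval] at h
  have hadj := (Polynomial.evalRingHom z).map_adjugate (charmatrix H)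
  simp only [RingHom.mapMatrix_apply, charmatrix_map_eval] at hadj
  rw [hadj] at h
  simpa [Matrix.charpoly, pow_two] using h

/-- The trace of the product of two resolvents, cleared of denominators. -/
theorem Matrix.trace_adjugate_mul_adjugate {N K : Type*} [Fintype N] [DecidableEq N] [Field K]
    (H : Matrix N N K) {z w : K} (hzw : z ≠ w) :
    (adjugate (scalar N z - H) * adjugate (scalar N w - H)).trace =
      1 / (w - z) * (H.charpoly.derivative.eval z * H.charpoly.eval w
        - H.charpoly.derivative.eval w * H.charpoly.eval z) := by
  rw [← trace_adjugate_scalar_sub, ← trace_adjugate_scalar_sub, eval_charpoly, eval_charpoly]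
  set U := scalar N z - H
  set V := scalar N w - H
  have hUV : V - U = (w - z) • (1 : Matrix N N K) := by
    simp only [U, V, sub_sub_sub_cancel_right]
    ext i j; by_cases h : i = j <;> simp [h]
  -- the resolvent identity, multiplied by the two determinants
  have h : (w - z) • (adjugate U * adjugate V) = V.det • adjugate U - U.det • adjugate V := by
    have h1 : adjugate U * (V - U) * adjugate V = V.det • adjugate U - U.det • adjugate V := by
      rw [Matrix.mul_sub, Matrix.sub_mul, adjugate_mul, Matrix.mul_assoc, mul_adjugate]
      simp
    rw [← h1, hUV]
    simp
  have h2 := congrArg Matrix.trace h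
  rw [trace_smul, trace_sub, trace_smul, trace_smul, smul_eq_mul, smul_eq_mul, smul_eq_mul] at h2
  have h3 : w - z ≠ 0 := sub_ne_zero.mpr hzw.symm
  rw [one_div, eq_inv_mul_iff_mul_eq₀ h3, h2]
  ring

variable {ι N : Type*} [Fintype ι]

/-- The generic matrix `∑ a, x_a e_a` of a linear family, over the ring of polynomials in the
coordinates `x_a`. -/
noncomputable def genericPencil (e : ι → Matrix N N ℂ) : Matrix N N (MvPolynomial ι ℂ) :=
  Matrix.of fun i j => ∑ a, MvPolynomial.C (e a i j) * MvPolynomial.X a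

/-- The matrix `∑ a, x_a e_a` of a linear family. -/
def pencil (e : ι → Matrix N N ℂ) (x : ι → ℂ) : Matrix N N ℂ := ∑ a, x a • e a

theorem genericPencil_map_eval (e : ι → Matrix N N ℂ) (x : ι → ℂ) :
    (genericPencil e).map (MvPolynomial.eval x) = pencil e x := by
  ext i j
  simp [genericPencil, pencil, Matrix.sum_apply, mul_comm]

variable [Fintype N] [DecidableEq N]

/-- The value of the generic characteristic polynomial at the constant `z`. -/
noncomputable def pencilCharpoly (e : ι → Matrix N N ℂ) (z : ℂ) : MvPolynomial ι ℂ :=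
  (genericPencil e).charpoly.eval (MvPolynomial.C z)

theorem pencilCharpoly_eq_det (e : ι → Matrix N N ℂ) (z : ℂ) :
    pencilCharpoly e z = (scalar N (MvPolynomial.C z) - genericPencil e).det :=
  Matrix.eval_charpoly _ _

theorem charpoly_genericPencil_map_eval (e : ι → Matrix N N ℂ) (x : ι → ℂ) :
    (genericPencil e).charpoly.map (MvPolynomial.eval x) = (pencil e x).charpoly := by
  rw [← Matrix.charpoly_map, genericPencil_map_eval]

theorem eval_pencilCharpoly (e : ι → Matrix N N ℂ) (x : ι → ℂ) (z : ℂ) :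
    MvPolynomial.eval x (pencilCharpoly e z) = (pencil e x).charpoly.eval z := by
  rw [← charpoly_genericPencil_map_eval, Polynomial.eval_map, pencilCharpoly,
    ← Polynomial.eval₂_at_apply, MvPolynomial.eval_C]

theorem scalar_sub_genericPencil_map_eval (e : ι → Matrix N N ℂ) (x : ι → ℂ) (z : ℂ) :
    (scalar N (MvPolynomial.C z) - genericPencil e).map (MvPolynomial.eval x) =
      scalar N z - pencil e x := by
  ext i j
  rw [← genericPencil_map_eval]
  by_cases h : i = j <;> simp [h]

variable [DecidableEq ι]

theorem scalar_sub_genericPencil_map_pderiv (e : ι → Matrix N N ℂ) (z : ℂ) (a : ι) :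
    (scalar N (MvPolynomial.C z) - genericPencil e).map (MvPolynomial.pderiv a) =
      -(e a).map MvPolynomial.C := by
  ext1 i j
  have h : MvPolynomial.pderiv a (scalar N (MvPolynomial.C (σ := ι) z) i j) = 0 := by
    by_cases h : i = j <;> simp [h]
  rw [Matrix.map_apply, Matrix.sub_apply, map_sub, h]
  simp [genericPencil, MvPolynomial.pderiv_X, Pi.single_apply]

theorem eval_pderiv_pencilCharpoly (e : ι → Matrix N N ℂ) (x : ι → ℂ) (z : ℂ) (a : ι) :
    MvPolynomial.eval x (MvPolynomial.pderiv a (pencilCharpoly e z)) =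
      -(adjugate (scalar N z - pencil e x) * e a).trace := by
  rw [pencilCharpoly_eq_det, Derivation.map_det, scalar_sub_genericPencil_map_pderiv]
  rw [RingHom.map_trace_adjugate_mul, scalar_sub_genericPencil_map_eval, ← trace_neg,
    ← Matrix.mul_neg]
  congr 2
  ext i j
  simp

/-- The carré du champ of two values of the characteristic polynomial of a linear family whose
tensor `∑ g a b (e a ⊗ e b)` is `c` times the flip. -/
theorem sum_pderiv_mul_pderiv_pencilCharpoly (e : ι → Matrix N N ℂ) (g : ι → ι → ℂ) (c : ℂ)
    (hc : ∀ i j k l, ∑ a, ∑ b, g a b * (e a i j * e b k l) = if i = l ∧ j = k then c else 0)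
    (x : ι → ℂ) (z w : ℂ) :
    ∑ a, ∑ b, g a b * (MvPolynomial.eval x (MvPolynomial.pderiv a (pencilCharpoly e z)) *
        MvPolynomial.eval x (MvPolynomial.pderiv b (pencilCharpoly e w))) =
      c * (adjugate (scalar N z - pencil e x) * adjugate (scalar N w - pencil e x)).trace := by
  simp only [eval_pderiv_pencilCharpoly, neg_mul_neg]
  rw [sum_trace_mul_trace_of_casimir g e c hc]

/-- On the characteristic polynomial of such a family, the operator acts as `-c d²/dz²`. -/
theorem eval_polyDiffusion_pencilCharpoly (e : ι → Matrix N N ℂ) (g : ι → ι → ℂ) (c : ℂ)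
    (hc : ∀ i j k l, ∑ a, ∑ b, g a b * (e a i j * e b k l) = if i = l ∧ j = k then c else 0)
    (x : ι → ℂ) (z : ℂ) :
    MvPolynomial.eval x (polyDiffusion g (pencilCharpoly e z)) =
      -(c * (pencil e x).charpoly.derivative.derivative.eval z) := by
  -- the identity multiplied by the characteristic polynomial
  have h1 : ∀ z : ℂ, (pencil e x).charpoly.eval z *
      (MvPolynomial.eval x (polyDiffusion g (pencilCharpoly e z)) +
        c * (pencil e x).charpoly.derivative.derivative.eval z) = 0 := by
    intro z
    set U := adjugate (scalar N z - pencil e x) with hU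
    have hterm : ∀ a b, (pencil e x).charpoly.eval z *
        MvPolynomial.eval x (MvPolynomial.pderiv a (MvPolynomial.pderiv b (pencilCharpoly e z))) =
        (U * e a).trace * (U * e b).trace - (U * e a * (U * e b)).trace := by
      intro a b
      have hZ : ((scalar N (MvPolynomial.C z) - genericPencil e).map
          (MvPolynomial.pderiv b)).map (MvPolynomial.pderiv a) = 0 := by
        rw [scalar_sub_genericPencil_map_pderiv]
        ext1 i j
        simp
      have he : ∀ a, (-(e a).map (MvPolynomial.C (σ := ι))).map (MvPolynomial.eval x) = -e a := by
        intro a; ext i j; simp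
      have h := congrArg (MvPolynomial.eval x) (Derivation.det_mul_map_map_det _ _ _ hZ)
      simp only [scalar_sub_genericPencil_map_pderiv] at h
      rw [← pencilCharpoly_eq_det, map_sub, map_mul, map_mul, Matrix.mul_assoc,
        RingHom.map_trace_adjugate_mul, RingHom.map_trace_adjugate_mul,
        RingHom.map_trace_adjugate_mul, Matrix.map_mul, Matrix.map_mul, he, he,
        scalar_sub_genericPencil_map_eval, eval_pencilCharpoly] at h
      have hadj := (MvPolynomial.eval x).map_adjugate
        (scalar N (MvPolynomial.C z) - genericPencil e)
      simp only [RingHom.mapMatrix_apply, scalar_sub_genericPencil_map_eval] at hadj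
      rw [hadj] at h
      rw [h]
      simp [hU, Matrix.mul_assoc]
    rw [mul_add, mul_left_comm, eval_charpoly_mul_eval_derivative_derivative, ← hU,
      eval_polyDiffusion, Finset.mul_sum]
    simp only [Finset.mul_sum, mul_left_comm _ (g _ _), hterm, mul_sub, Finset.sum_sub_distrib]
    rw [sum_trace_mul_trace_of_casimir g e c hc, sum_trace_mul_mul_mul_of_casimir g e c hc]
    ring
  -- both sides are polynomials in `z`, so that the nonzero characteristic polynomial cancels
  let Λ : Polynomial ℂ := ∑ k ∈ Finset.range ((genericPencil e).charpoly.natDegree + 1),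
    Polynomial.monomial k
      (MvPolynomial.eval x (polyDiffusion g ((genericPencil e).charpoly.coeff k)))
  have hΛ : ∀ z, Λ.eval z = MvPolynomial.eval x (polyDiffusion g (pencilCharpoly e z)) := by
    intro z
    rw [pencilCharpoly, Polynomial.eval_eq_sum_range (p := (genericPencil e).charpoly), map_sum,
      map_sum, Polynomial.eval_finsetSum]
    refine Finset.sum_congr rfl fun k _ => ?_
    rw [Polynomial.eval_monomial, ← map_pow, mul_comm _ (MvPolynomial.C _),
      ← MvPolynomial.smul_eq_C_mul, map_smul, MvPolynomial.smul_eval, mul_comm]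
  have h2 : (pencil e x).charpoly *
      (Λ + Polynomial.C c * (pencil e x).charpoly.derivative.derivative) = 0 := by
    refine Polynomial.funext fun z => ?_
    simpa [hΛ] using h1 z
  have h3 := (mul_eq_zero.mp h2).resolve_left (charpoly_monic _).ne_zero
  have h4 := congrArg (Polynomial.eval z) h3
  simp only [Polynomial.eval_add, Polynomial.eval_mul, Polynomial.eval_C, Polynomial.eval_zero,
    hΛ] at h4
  exact eq_neg_of_add_eq_zero_left h4

end LinearFamily

/-! ### Real parts, and families that are Hermitian on the image of a projection -/

section RealPart

open MvPolynomial

variable {ι : Type*}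

/-- The polynomial whose coefficients are the real parts of those of `f`. -/
noncomputable def rePart (f : MvPolynomial ι ℂ) : MvPolynomial ι ℝ :=
  AddMonoidAlgebra.map Complex.reAddGroupHom f

/-- The polynomial whose coefficients are the imaginary parts of those of `f`. -/
noncomputable def imPart (f : MvPolynomial ι ℂ) : MvPolynomial ι ℝ :=
  AddMonoidAlgebra.map Complex.imAddGroupHom f

theorem coeff_rePart (f : MvPolynomial ι ℂ) (m : ι →₀ ℕ) : (rePart f).coeff m = (f.coeff m).re :=
  rfl

theorem coeff_imPart (f : MvPolynomial ι ℂ) (m : ι →₀ ℕ) : (imPart f).coeff m = (f.coeff m).im :=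
  rfl

theorem map_rePart_add_map_imPart (f : MvPolynomial ι ℂ) :
    map Complex.ofRealHom (rePart f) + C Complex.I * map Complex.ofRealHom (imPart f) = f := by
  ext m
  rw [coeff_add, coeff_C_mul, coeff_map, coeff_map, coeff_rePart, coeff_imPart]
  simp [mul_comm Complex.I, Complex.re_add_im]

theorem eval_map_ofReal (f : MvPolynomial ι ℝ) (x : ι → ℝ) :
    eval (fun a => (x a : ℂ)) (map Complex.ofRealHom f) = (eval x f : ℂ) := by
  rw [eval_map]
  exact (eval₂_comp_left Complex.ofRealHom (RingHom.id ℝ) x f).symm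

theorem Polynomial.eval_map_ofRealHom (p : Polynomial ℝ) (z : ℝ) :
    (p.map Complex.ofRealHom).eval (z : ℂ) = ((p.eval z : ℝ) : ℂ) := by
  rw [Polynomial.eval_map]
  exact Polynomial.eval₂_at_apply Complex.ofRealHom z

theorem eval_rePart (f : MvPolynomial ι ℂ) (x : ι → ℝ) :
    eval x (rePart f) = (eval (fun a => (x a : ℂ)) f).re := by
  conv_rhs => rw [← map_rePart_add_map_imPart f, map_add, map_mul, eval_map_ofReal,
    eval_map_ofReal, eval_C]
  simp

theorem eval_imPart (f : MvPolynomial ι ℂ) (x : ι → ℝ) :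
    eval x (imPart f) = (eval (fun a => (x a : ℂ)) f).im := by
  conv_rhs => rw [← map_rePart_add_map_imPart f, map_add, map_mul, eval_map_ofReal,
    eval_map_ofReal, eval_C]
  simp

theorem rePart_one : rePart (1 : MvPolynomial ι ℂ) = 1 := by
  classical
  ext m
  rw [coeff_rePart, coeff_one, coeff_one]
  split_ifs <;> simp

end RealPart

section HermitianFamily

open Matrix

theorem Matrix.IsHermitian.im_coeff_charpoly {N : Type*} [Fintype N] [DecidableEq N]
    {H : Matrix N N ℂ} (hH : H.IsHermitian) (k : ℕ) : (H.charpoly.coeff k).im = 0 := by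
  have h : H.charpoly.map (starRingEnd ℂ) = H.charpoly := by
    rw [← Matrix.charpoly_map, ← Matrix.charpoly_transpose]
    exact congrArg Matrix.charpoly hH
  rw [← Complex.conj_eq_iff_im]
  conv_rhs => rw [← h]
  rw [Polynomial.coeff_map]

variable {ι N : Type*} [Fintype ι] [Fintype N] [DecidableEq N]

/-- The polynomial whose coefficients are the real parts of the coefficients of the generic
characteristic polynomial of a linear family. -/
noncomputable def realPencilPoly (e : ι → Matrix N N ℂ) : Polynomial (MvPolynomial ι ℝ) :=
  ∑ k ∈ Finset.range (Fintype.card N + 1),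
    Polynomial.monomial k (rePart ((genericPencil e).charpoly.coeff k))

theorem coeff_realPencilPoly (e : ι → Matrix N N ℂ) (k : ℕ) :
    (realPencilPoly e).coeff k = rePart ((genericPencil e).charpoly.coeff k) := by
  simp only [realPencilPoly, Polynomial.finsetSum_coeff, Polynomial.coeff_monomial,
    Finset.sum_ite_eq', Finset.mem_range]
  split_ifs with h
  · rfl
  · rw [Polynomial.coeff_eq_zero_of_natDegree_lt]
    · simp [rePart]
    · rw [charpoly_natDegree_eq_dim]; omega

theorem natDegree_realPencilPoly_le (e : ι → Matrix N N ℂ) :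
    (realPencilPoly e).natDegree ≤ Fintype.card N :=
  Polynomial.natDegree_le_iff_coeff_eq_zero.mpr fun k hk => by
    rw [coeff_realPencilPoly, Polynomial.coeff_eq_zero_of_natDegree_lt]
    · simp [rePart]
    · rwa [charpoly_natDegree_eq_dim]

theorem coeff_card_realPencilPoly (e : ι → Matrix N N ℂ) :
    (realPencilPoly e).coeff (Fintype.card N) = 1 := by
  have h := charpoly_monic (genericPencil e)
  rw [Polynomial.Monic, Polynomial.leadingCoeff, charpoly_natDegree_eq_dim] at h
  rw [coeff_realPencilPoly, h, rePart_one]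

theorem monic_realPencilPoly (e : ι → Matrix N N ℂ) : (realPencilPoly e).Monic :=
  Polynomial.monic_of_natDegree_le_of_coeff_eq_one _ (natDegree_realPencilPoly_le e)
    (coeff_card_realPencilPoly e)

theorem natDegree_realPencilPoly (e : ι → Matrix N N ℂ) :
    (realPencilPoly e).natDegree = Fintype.card N :=
  Polynomial.natDegree_eq_of_le_of_coeff_ne_zero (natDegree_realPencilPoly_le e)
    (by rw [coeff_card_realPencilPoly]; exact one_ne_zero)

theorem coeff_specializeAt_realPencilPoly (e : ι → Matrix N N ℂ) (x : ι → ℝ) (k : ℕ) :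
    (specializeAt (realPencilPoly e) x).coeff k =
      ((pencil e fun a => (x a : ℂ)).charpoly.coeff k).re := by
  rw [specializeAt, Polynomial.coeff_map, coeff_realPencilPoly, eval_rePart,
    ← charpoly_genericPencil_map_eval, Polynomial.coeff_map]

theorem eval_specializeAt {ι : Type*} (Q : Polynomial (MvPolynomial ι ℝ)) (x : ι → ℝ) (X : ℝ) :
    (specializeAt Q x).eval X = MvPolynomial.eval x (Q.eval (MvPolynomial.C X)) := by
  rw [specializeAt, Polynomial.eval_map, ← Polynomial.eval₂_at_apply, MvPolynomial.eval_C]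

theorem map_ofReal_specializeAt_realPencilPoly {e : ι → Matrix N N ℂ} {x : ι → ℝ}
    (hx : (pencil e fun a => (x a : ℂ)).IsHermitian) :
    (specializeAt (realPencilPoly e) x).map Complex.ofRealHom =
      (pencil e fun a => (x a : ℂ)).charpoly := by
  ext k
  rw [Polynomial.coeff_map, coeff_specializeAt_realPencilPoly]
  exact Complex.ext (by simp) (by simp [hx.im_coeff_charpoly k])

theorem eval_C_realPencilPoly (e : ι → Matrix N N ℂ) (X : ℝ) :
    (realPencilPoly e).eval (MvPolynomial.C X) = rePart (pencilCharpoly e X) := by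
  refine MvPolynomial.funext fun x => ?_
  rw [← eval_specializeAt, eval_rePart, eval_pencilCharpoly,
    Polynomial.eval_eq_sum_range' (n := Fintype.card N + 1), Polynomial.eval_eq_sum_range,
    charpoly_natDegree_eq_dim, Complex.re_sum]
  · refine Finset.sum_congr rfl fun k _ => ?_
    rw [coeff_specializeAt_realPencilPoly, ← Complex.ofReal_pow, Complex.re_mul_ofReal]
  · exact Nat.lt_succ_of_le
      (Polynomial.natDegree_map_le.trans (natDegree_realPencilPoly_le e))

/-- A linear family of matrices that is Hermitian on the image of the projection `g`, and for which
the tensor `∑ g a b (e a ⊗ e b)` is `c` times the flip. -/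
structure IsHermitianFamily (g : ι → ι → ℝ) (e : ι → Matrix N N ℂ) (c : ℝ) : Prop where
  proj : IsProjectionForm g
  casimir : ∀ i j k l, ∑ a, ∑ b, (g a b : ℂ) * (e a i j * e b k l) =
    if i = l ∧ j = k then (c : ℂ) else 0
  isHermitian : ∀ x ∈ fixedPoints g, (pencil e fun a => (x a : ℂ)).IsHermitian

variable {g : ι → ι → ℝ} {e : ι → Matrix N N ℂ} {c : ℝ}

namespace IsHermitianFamily

/-- The characteristic polynomial of a Hermitian matrix is real. -/
theorem eval_imPart_eq_zero (h : IsHermitianFamily g e c) (X : ℝ) :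
    ∀ x ∈ fixedPoints g, MvPolynomial.eval x (imPart (pencilCharpoly e X)) = 0 := by
  intro x hx
  rw [eval_imPart, eval_pencilCharpoly,
    ← map_ofReal_specializeAt_realPencilPoly (h.isHermitian x hx),
    Polynomial.eval_map_ofRealHom, Complex.ofReal_im]

variable [DecidableEq ι]

/-- The operator acts on the characteristic polynomial as `-c d²/dX²`. -/
theorem diffusionOp_eq (h : IsHermitianFamily g e c) {x : ι → ℝ} (hx : x ∈ fixedPoints g) (X : ℝ) :
    diffusionOp g (fun y => (specializeAt (realPencilPoly e) y).eval X) x =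
      -(c * (specializeAt (realPencilPoly e) x).derivative.derivative.eval X) := by
  simp only [eval_specializeAt]
  rw [diffusionOp_eval, eval_C_realPencilPoly]
  have h1 := eval_polyDiffusion_pencilCharpoly e (fun a b => (g a b : ℂ)) c h.casimir
    (fun a => (x a : ℂ)) X
  have h2 := h.proj.polyDiffusion_eq_zero (h.eval_imPart_eq_zero X) hx
  have h3 := eval_map_polyDiffusion Complex.ofRealHom g
  simp only [Complex.ofRealHom_eq_coe] at h3
  rw [← map_rePart_add_map_imPart (pencilCharpoly e X), ← MvPolynomial.smul_eq_C_mul, map_add,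
    map_smul, h3, h3, map_add, MvPolynomial.smul_eval, eval_map_ofReal, eval_map_ofReal, h2,
    ← map_ofReal_specializeAt_realPencilPoly (h.isHermitian x hx), Polynomial.derivative_map,
    Polynomial.derivative_map, Polynomial.eval_map_ofRealHom] at h1
  apply Complex.ofReal_injective
  simpa using h1

/-- The imaginary part of the generic characteristic polynomial contributes nothing, because it
vanishes on the image of the projection and hence has zero derivatives along it. -/
theorem carreDuChamp_eq_re (h : IsHermitianFamily g e c) {x : ι → ℝ} (hx : x ∈ fixedPoints g)
    (X Y : ℝ) :
    carreDuChamp (diffusionOp g) (fun y => (specializeAt (realPencilPoly e) y).eval X)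
        (fun y => (specializeAt (realPencilPoly e) y).eval Y) x =
      ((c : ℂ) * (adjugate (scalar N (X : ℂ) - pencil e fun a => (x a : ℂ)) *
        adjugate (scalar N (Y : ℂ) - pencil e fun a => (x a : ℂ))).trace).re := by
  have h1 := sum_pderiv_mul_pderiv_pencilCharpoly e (fun a b => (g a b : ℂ)) c h.casimir
    (fun a => (x a : ℂ)) X Y
  have hd : ∀ (Z : ℝ) (a : ι),
      MvPolynomial.eval (fun a => (x a : ℂ)) (MvPolynomial.pderiv a (pencilCharpoly e Z)) =
      (MvPolynomial.eval x (MvPolynomial.pderiv a (rePart (pencilCharpoly e Z))) : ℂ) + Complex.I *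
      (MvPolynomial.eval x (MvPolynomial.pderiv a (imPart (pencilCharpoly e Z))) : ℂ) := by
    intro Z a
    conv_lhs => rw [← map_rePart_add_map_imPart (pencilCharpoly e Z)]
    rw [map_add, MvPolynomial.pderiv_C_mul, MvPolynomial.pderiv_map, MvPolynomial.pderiv_map,
      map_add, map_mul, MvPolynomial.eval_C, eval_map_ofReal, eval_map_ofReal]
  have him : ∀ u : ι → ℝ, ∑ a, ∑ b, g a b * (u a *
      MvPolynomial.eval x (MvPolynomial.pderiv b (imPart (pencilCharpoly e Y)))) = 0 := by
    intro u
    refine Finset.sum_eq_zero fun a _ => ?_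
    have := h.proj.sum_pderiv_eq_zero (h.eval_imPart_eq_zero Y) hx a
    simp only [mul_left_comm _ (u a), ← Finset.mul_sum, this, mul_zero]
  simp only [eval_specializeAt]
  rw [carreDuChamp_diffusionOp_eval g h.proj.symm, eval_C_realPencilPoly, eval_C_realPencilPoly]
  -- the real part of the complex identity, where the product of the imaginary parts drops out
  have hre : ∀ γ A B C D : ℝ, ((γ : ℂ) * ((A + Complex.I * B) * (C + Complex.I * D))).re =
      γ * (A * C) - γ * (B * D) := by
    intro γ A B C D
    simp
    ring
  have h2 := congrArg Complex.re h1
  simp only [hd, Complex.re_sum, hre, Finset.sum_sub_distrib] at h2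
  have h4 := him fun a => MvPolynomial.eval x (MvPolynomial.pderiv a (imPart (pencilCharpoly e X)))
  rwa [h4, sub_zero] at h2

theorem carreDuChamp_eq (h : IsHermitianFamily g e c) {x : ι → ℝ} (hx : x ∈ fixedPoints g)
    {X Y : ℝ} (hXY : X ≠ Y) :
    carreDuChamp (diffusionOp g) (fun y => (specializeAt (realPencilPoly e) y).eval X)
        (fun y => (specializeAt (realPencilPoly e) y).eval Y) x =
      c * (1 / (Y - X) * ((specializeAt (realPencilPoly e) x).derivative.eval X *
          (specializeAt (realPencilPoly e) x).eval Y
        - (specializeAt (realPencilPoly e) x).derivative.eval Y *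
          (specializeAt (realPencilPoly e) x).eval X)) := by
  rw [h.carreDuChamp_eq_re hx, Matrix.trace_adjugate_mul_adjugate _ (by exact_mod_cast hXY),
    ← map_ofReal_specializeAt_realPencilPoly (h.isHermitian x hx), Polynomial.derivative_map]
  simp only [Polynomial.eval_map_ofRealHom]
  norm_cast

/-- The confluent case `X = Y` of `IsHermitianFamily.carreDuChamp_eq`. -/
theorem carreDuChamp_self (h : IsHermitianFamily g e c) {x : ι → ℝ} (hx : x ∈ fixedPoints g)
    (X : ℝ) :
    carreDuChamp (diffusionOp g) (fun y => (specializeAt (realPencilPoly e) y).eval X)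
        (fun y => (specializeAt (realPencilPoly e) y).eval X) x =
      c * ((specializeAt (realPencilPoly e) x).derivative.eval X ^ 2 -
          (specializeAt (realPencilPoly e) x).eval X *
            (specializeAt (realPencilPoly e) x).derivative.derivative.eval X) := by
  have h1 := Matrix.eval_charpoly_mul_eval_derivative_derivative
    (pencil e fun a => (x a : ℂ)) (X : ℂ)
  rw [Matrix.trace_adjugate_scalar_sub, eq_sub_iff_add_eq, ← eq_sub_iff_add_eq'] at h1
  rw [h.carreDuChamp_eq_re hx, h1,
    ← map_ofReal_specializeAt_realPencilPoly (h.isHermitian x hx), Polynomial.derivative_map,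
    Polynomial.derivative_map]
  simp only [Polynomial.eval_map_ofRealHom]
  norm_cast

end IsHermitianFamily

end HermitianFamily

/-! ### Signs of the Clifford algebra -/

section CliffordSign

variable {p : ℕ}

theorem genSign_mul_self (i j : Fin p) : genSign i j * genSign i j = 1 := by
  unfold genSign; split_ifs <;> norm_num

theorem cliffordSign_mul_self (A B : Finset (Fin p)) : cliffordSign A B * cliffordSign A B = 1 := by
  simp [cliffordSign, ← Finset.prod_mul_distrib, genSign_mul_self]

theorem cliffordSign_empty_left (B : Finset (Fin p)) : cliffordSign ∅ B = 1 := by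
  simp [cliffordSign]

theorem Finset.prod_symmDiff_of_mul_self {α M : Type*} [DecidableEq α] [CommMonoid M]
    (A B : Finset α) (f : α → M) (hf : ∀ a, f a * f a = 1) :
    ∏ i ∈ symmDiff A B, f i = (∏ i ∈ A, f i) * ∏ i ∈ B, f i := by
  have h : (∏ i ∈ A ∩ B, f i) * ∏ i ∈ A ∩ B, f i = 1 := by
    simp [← Finset.prod_mul_distrib, hf]
  rw [symmDiff_def, Finset.sup_eq_union, Finset.prod_union disjoint_sdiff_sdiff,
    ← Finset.prod_inter_mul_prod_sdiff A B, ← Finset.prod_inter_mul_prod_sdiff B A,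
    Finset.inter_comm B A, mul_mul_mul_comm, h, one_mul]

theorem cliffordSign_symmDiff_left (A B C : Finset (Fin p)) :
    cliffordSign (symmDiff A B) C = cliffordSign A C * cliffordSign B C :=
  Finset.prod_symmDiff_of_mul_self _ _ _ fun i => by
    simp [← Finset.prod_mul_distrib, genSign_mul_self]

theorem cliffordSign_symmDiff_right (A B C : Finset (Fin p)) :
    cliffordSign A (symmDiff B C) = cliffordSign A B * cliffordSign A C := by
  simp only [cliffordSign]
  rw [← Finset.prod_mul_distrib]
  exact Finset.prod_congr rfl fun i _ =>
    Finset.prod_symmDiff_of_mul_self _ _ _ fun j => genSign_mul_self i j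

theorem genSign_mul_genSign_swap (i j : Fin p) :
    genSign i j * genSign j i = if i = j then 1 else -1 := by
  unfold genSign
  rcases lt_trichotomy i j with h | h | h
  · simp [h, h.ne, not_lt.mpr h.le]
  · simp [h]
  · simp [h, h.ne', not_lt.mpr h.le]

/-- `(i|C)(C|i)` is the sign picked up when `ω_i` is moved past `ω_C`. -/
theorem cliffordSign_singleton_mul_swap (i : Fin p) (C : Finset (Fin p)) :
    cliffordSign {i} C * cliffordSign C {i} = (-1) ^ (C.erase i).card := by
  simp only [cliffordSign, Finset.prod_singleton, ← Finset.prod_mul_distrib,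
    genSign_mul_genSign_swap]
  rw [← Finset.prod_const, ← Finset.prod_subset (Finset.erase_subset i C)]
  · exact Finset.prod_congr rfl fun j hj => if_neg (Finset.ne_of_mem_erase hj).symm
  · intro j hj hj'
    rw [if_pos]
    by_contra h
    exact hj' (Finset.mem_erase.mpr ⟨Ne.symm h, hj⟩)

/-- The volume element squares to `-1` when `p = 4 m + 1`. -/
theorem cliffordSign_univ (m : ℕ) (hp : p = 4 * m + 1) :
    cliffordSign (Finset.univ : Finset (Fin p)) Finset.univ = -1 := by
  have h1 : ∀ i : Fin p, ∏ j, genSign i j = (-1) ^ (i.val + 1) := by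
    intro i
    have h : ∀ j : Fin p, genSign i j = if j ≤ i then -1 else 1 := by
      intro j
      unfold genSign
      by_cases h : i < j <;> simp [h, not_le.mpr, not_lt.mp]
    simp only [h, Finset.prod_ite, Finset.prod_const, one_pow, mul_one]
    congr 1
    rw [show Finset.univ.filter (fun j => j ≤ i) = Finset.Iic i by ext; simp, Fin.card_Iic]
  simp only [cliffordSign, h1]
  rw [Finset.prod_pow_eq_pow_sum, Finset.sum_add_distrib, Fin.sum_univ_eq_sum_range (fun i => i)]
  subst hp
  have h2 := Finset.sum_range_id_mul_two (4 * m + 1)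
  have h3 : ∑ i ∈ Finset.range (4 * m + 1), i = (4 * m + 1) * (2 * m) := by
    have : (4 * m + 1) * (4 * m + 1 - 1) = (4 * m + 1) * (2 * m) * 2 := by
      rw [Nat.add_sub_cancel]; ring
    omega
  rw [h3]
  simp only [Finset.sum_const, Finset.card_univ, Fintype.card_fin, smul_eq_mul, mul_one]
  apply Odd.neg_one_pow
  exact ⟨(4 * m + 1) * m + 2 * m, by ring⟩

end CliffordSign

/-! ### Products of anticommuting square roots of `-1` -/

section CliffordMonomial

variable {p : ℕ} {R : Type*} [Ring R]

/-- The product of the `γ i`, `i ∈ A`, in increasing order. -/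
def cliffordMonomial (γ : Fin p → R) (A : Finset (Fin p)) : R :=
  ((List.finRange p).map fun j => if j ∈ A then γ j else 1).prod

theorem cliffordMonomial_empty (γ : Fin p → R) : cliffordMonomial γ ∅ = 1 := by
  simp [cliffordMonomial]

variable [Algebra ℝ R]

/-- Moving `γ i` into its place in the ordered product changes the sign once for each smaller
factor, and once more if `γ i` is already there. -/
theorem generator_mul_cliffordMonomial {γ : Fin p → R} (hsq : ∀ i, γ i * γ i = -1)
    (hac : ∀ i j, i ≠ j → γ i * γ j = -(γ j * γ i)) (i : Fin p) (B : Finset (Fin p)) :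
    γ i * cliffordMonomial γ B = cliffordSign {i} B • cliffordMonomial γ (symmDiff {i} B) := by
  have hmem : ∀ j, j ∈ symmDiff {i} B ↔ (j = i ∧ j ∉ B ∨ j ∈ B ∧ j ≠ i) := by
    intro j; simp [Finset.mem_symmDiff]
  -- beyond `i`, the two products agree and carry no sign
  have key : ∀ l : List (Fin p), l.Pairwise (· < ·) → i ∈ l →
      γ i * (l.map fun j => if j ∈ B then γ j else 1).prod =
        (l.map fun j => if j ∈ B then genSign i j else 1).prod •
          (l.map fun j => if j ∈ symmDiff {i} B then γ j else 1).prod := by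
    intro l
    induction l with
    | nil => simp
    | cons h t ih =>
      intro hl hi
      rw [List.pairwise_cons] at hl
      simp only [List.map_cons, List.prod_cons]
      by_cases hh : h = i
      · subst hh
        have h1 : (t.map fun j => if j ∈ symmDiff {h} B then γ j else 1) =
            t.map fun j => if j ∈ B then γ j else 1 :=
          List.map_congr_left fun j hj => by
            simp [hmem, (hl.1 j hj).ne']
        have h2 : (t.map fun j => if j ∈ B then genSign h j else 1).prod = 1 :=
          List.prod_eq_one fun a ha => by
            obtain ⟨j, hj, rfl⟩ := List.mem_map.mp ha
            simp [genSign, hl.1 j hj]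
        rw [h1, h2]
        by_cases hB : h ∈ B
        · simp [hmem, hB, genSign, ← mul_assoc, hsq]
        · simp [hmem, hB]
      · have hit : i ∈ t := (List.mem_cons.mp hi).resolve_left (Ne.symm hh)
        have hlt : h < i := hl.1 i hit
        have h3 := ih hl.2 hit
        by_cases hB : h ∈ B
        · simp only [hmem, hB, hh, if_true, genSign, not_lt.mpr hlt.le, if_false, ne_eq,
            not_false_eq_true, and_self, or_true, ← mul_assoc, hac i h (Ne.symm hh)]
          simp only [neg_mul, mul_assoc, h3, one_mul, neg_smul]
          simp [hmem, genSign]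
        · simp only [hmem, hB, hh, if_false, false_and, or_self, one_mul, h3]
  have h := key _ (List.pairwise_lt_finRange p) (List.mem_finRange i)
  rw [cliffordMonomial, h, cliffordMonomial]
  congr 1
  rw [← Fin.prod_univ_def, cliffordSign, Finset.prod_singleton, Finset.prod_ite_mem,
    Finset.univ_inter]

theorem cliffordMonomial_mul {γ : Fin p → R} (hsq : ∀ i, γ i * γ i = -1)
    (hac : ∀ i j, i ≠ j → γ i * γ j = -(γ j * γ i)) (A B : Finset (Fin p)) :
    cliffordMonomial γ A * cliffordMonomial γ B =
      cliffordSign A B • cliffordMonomial γ (symmDiff A B) := by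
  induction A using Finset.induction_on with
  | empty =>
    rw [cliffordMonomial_empty, cliffordSign_empty_left, one_mul, one_smul, ← Finset.bot_eq_empty,
      bot_symmDiff]
  | insert i A hi ih =>
    have hiA : symmDiff {i} A = insert i A := by
      ext j; simp only [Finset.mem_symmDiff, Finset.mem_singleton, Finset.mem_insert]
      constructor
      · tauto
      · rintro (rfl | h)
        · exact Or.inl ⟨rfl, hi⟩
        · exact Or.inr ⟨h, by rintro rfl; exact hi h⟩
    have h1 := generator_mul_cliffordMonomial hsq hac i A
    have h2 : cliffordMonomial γ (symmDiff {i} A) =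
        cliffordSign {i} A • (γ i * cliffordMonomial γ A) := by
      rw [h1, smul_smul, cliffordSign_mul_self, one_smul]
    rw [← hiA, h2, smul_mul_assoc, mul_assoc, ih, mul_smul_comm,
      generator_mul_cliffordMonomial hsq hac, smul_smul, smul_smul, symmDiff_assoc,
      cliffordSign_symmDiff_left, cliffordSign_symmDiff_right]
    congr 1
    have := cliffordSign_mul_self {i} A
    linear_combination (cliffordSign A B * cliffordSign {i} B) * this

end CliffordMonomial

/-! ### Clifford matrices -/

section Gamma

open Matrix

/-- The Pauli construction: `2 q + 1` anticommuting anti-Hermitian square roots of `-1` in dimension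
`2 ^ q`. From `γ_j` one passes to `γ_j ⊗ σ_x`, `1 ⊗ i σ_y`, `1 ⊗ i σ_z`. -/
theorem exists_clifford_generators (q : ℕ) :
    ∃ (κ : Type) (_ : Fintype κ) (_ : DecidableEq κ) (γ : Fin (2 * q + 1) → Matrix κ κ ℂ),
      Fintype.card κ = 2 ^ q ∧ (∀ i, γ i * γ i = -1) ∧
      (∀ i j, i ≠ j → γ i * γ j = -(γ j * γ i)) ∧ ∀ i, (γ i)ᴴ = -γ i := by
  induction q with
  | zero =>
    refine ⟨Unit, inferInstance, inferInstance, fun _ => Complex.I • 1, by simp, ?_, ?_, ?_⟩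
    · intro i; simp [smul_smul]
    · intro i j hij; exact absurd (Fin.ext (by omega)) hij
    · intro i; simp
  | succ q ih =>
    obtain ⟨κ, _, _, γ, hcard, hsq, hac, hstar⟩ := ih
    have hneg : ∀ A B C D : Matrix κ κ ℂ, -fromBlocks A B C D = fromBlocks (-A) (-B) (-C) (-D) :=
      fun A B C D => fromBlocks_neg A B C D
    refine ⟨κ ⊕ κ, inferInstance, inferInstance,
      Fin.cons (fromBlocks 0 1 (-1) 0) (Fin.cons (fromBlocks (Complex.I • 1) 0 0 (-Complex.I • 1))
        fun j => fromBlocks 0 (γ j) (γ j) 0), ?_, ?_, ?_, ?_⟩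
    · simp [hcard, pow_succ, mul_two]
    · refine Fin.cases ?_ (Fin.cases ?_ fun i => ?_)
      · simp [fromBlocks_multiply, ← fromBlocks_one, hneg]
      · simp [fromBlocks_multiply, ← fromBlocks_one, hneg, smul_smul]
      · simp [fromBlocks_multiply, ← fromBlocks_one, hneg, hsq]
    · refine Fin.cases (Fin.cases ?_ (Fin.cases ?_ fun j => ?_))
        (Fin.cases (Fin.cases ?_ (Fin.cases ?_ fun j => ?_)) fun i =>
          (Fin.cases ?_ (Fin.cases ?_ fun j => ?_)))
      all_goals
        intro hij
        first
          | exact absurd rfl hij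
          | (simp [fromBlocks_multiply, hneg]; done)
          | simp [fromBlocks_multiply, hneg,
              hac _ _ fun h => hij (congrArg (Fin.succ ∘ Fin.succ) h)]
    · refine Fin.cases ?_ (Fin.cases ?_ fun i => ?_)
      · simp [fromBlocks_conjTranspose, hneg]
      · simp [fromBlocks_conjTranspose, hneg]
      · simp [fromBlocks_conjTranspose, hneg, hstar]

end Gamma

/-! ### Representations of the Clifford algebra and their orthogonality relations -/

section CliffordRep

open Matrix

/-- A system of matrices `ω_A` that multiply like the basis of the Clifford algebra, and for which
`A ↦ ω_A` is a `*`-representation. -/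
structure IsCliffordRep {p : ℕ} {κ : Type*} [Fintype κ] [DecidableEq κ]
    (ω : Finset (Fin p) → Matrix κ κ ℂ) : Prop where
  map_empty : ω ∅ = 1
  mul : ∀ A B, ω A * ω B = cliffordSign A B • ω (symmDiff A B)
  conjTranspose : ∀ A, (ω A)ᴴ = cliffordSign A A • ω A

/-- For `p = 4 m + 1` there is a representation of complex dimension `2 ^ (2 m)`. -/
theorem exists_isCliffordRep (m p : ℕ) (hp : p = 4 * m + 1) :
    ∃ (κ : Type) (_ : Fintype κ) (_ : DecidableEq κ) (ω : Finset (Fin p) → Matrix κ κ ℂ),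
      Fintype.card κ = 2 ^ (2 * m) ∧ IsCliffordRep ω := by
  obtain ⟨κ, i1, i2, γ, hcard, hsq, hac, hstar⟩ := exists_clifford_generators (2 * m)
  obtain rfl : p = 2 * (2 * m) + 1 := by omega
  have hmul := cliffordMonomial_mul hsq hac
  refine ⟨κ, i1, i2, cliffordMonomial γ, hcard, cliffordMonomial_empty γ, hmul, fun A => ?_⟩
  have hu : cliffordMonomial γ A ∈ unitary (Matrix κ κ ℂ) := by
    refine Submonoid.list_prod_mem _ fun x hx => ?_
    obtain ⟨j, -, rfl⟩ := List.mem_map.mp hx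
    split_ifs
    · rw [Unitary.mem_iff, star_eq_conjTranspose, hstar]
      simp [hsq]
    · exact one_mem _
  have h1 : (cliffordMonomial γ A)ᴴ * cliffordMonomial γ A = 1 := Unitary.star_mul_self_of_mem hu
  have h2 := hmul A A
  rw [symmDiff_self, Finset.bot_eq_empty, cliffordMonomial_empty] at h2
  calc (cliffordMonomial γ A)ᴴ
      = cliffordSign A A • ((cliffordMonomial γ A)ᴴ * (cliffordSign A A • 1)) := by
        rw [mul_smul_comm, smul_smul, cliffordSign_mul_self, one_smul, Matrix.mul_one]
    _ = cliffordSign A A • cliffordMonomial γ A := by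
        rw [← h2, ← Matrix.mul_assoc, h1, Matrix.one_mul]

/-- The square matrix whose rows are the entries of the `ω_A` and their complex conjugates. -/
noncomputable def cliffordEntries {p : ℕ} {κ : Type*}
    (ω : Finset (Fin p) → Matrix κ κ ℂ) :
    Matrix (Finset (Fin p)) (Bool × κ × κ) ℂ :=
  Matrix.of fun A r => bif r.1 then star (ω A r.2.1 r.2.2) else ω A r.2.1 r.2.2

namespace IsCliffordRep

variable {m p : ℕ} {κ : Type*} [Fintype κ] [DecidableEq κ] {ω : Finset (Fin p) → Matrix κ κ ℂ}

/-- An `ω_C` that anticommutes with a generator is traceless. -/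
theorem trace_eq_zero_of_odd (hω : IsCliffordRep ω) {C : Finset (Fin p)} {i : Fin p}
    (hi : Odd (C.erase i).card) : (ω C).trace = 0 := by
  have h1 : ω {i} * ω C = -(ω C * ω {i}) := by
    have h := cliffordSign_singleton_mul_swap i C
    rw [hi.neg_one_pow] at h
    rw [hω.mul, hω.mul, symmDiff_comm C, ← neg_smul]
    congr 1
    have h' := cliffordSign_mul_self C {i}
    linear_combination (-cliffordSign {i} C) * h' + cliffordSign C {i} * h
  have h2 : ω {i} * ω {i} = cliffordSign {i} {i} • (1 : Matrix κ κ ℂ) := by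
    rw [hω.mul, symmDiff_self, Finset.bot_eq_empty, hω.map_empty]
  have h3 : cliffordSign {i} {i} • (ω C).trace = -(cliffordSign {i} {i} • (ω C).trace) := by
    calc cliffordSign {i} {i} • (ω C).trace = (ω {i} * (ω {i} * ω C)).trace := by
          rw [← Matrix.mul_assoc, h2, Matrix.smul_mul, Matrix.one_mul, trace_smul]
      _ = -(ω C * ω {i} * ω {i}).trace := by
          rw [h1, Matrix.mul_neg, trace_neg, trace_mul_comm]
      _ = _ := by
          rw [Matrix.mul_assoc, h2, Matrix.mul_smul, Matrix.mul_one, trace_smul]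
  have h4 : cliffordSign {i} {i} • (ω C).trace = 0 := self_eq_neg.mp h3
  refine (smul_eq_zero.mp h4).resolve_left fun h0 => ?_
  simpa [h0] using cliffordSign_mul_self ({i} : Finset (Fin p)) {i}

/-- Every `ω_C` with `C` neither empty nor full anticommutes with some generator; the volume element
is central but anti-Hermitian, which is where `p = 4 m + 1` enters. -/
theorem re_trace_eq_zero (hω : IsCliffordRep ω) (hp : p = 4 * m + 1) {C : Finset (Fin p)}
    (hC : C.Nonempty) : (ω C).trace.re = 0 := by
  rcases Nat.even_or_odd C.card with he | ho
  · obtain ⟨i, hi⟩ := hC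
    rw [hω.trace_eq_zero_of_odd (i := i), Complex.zero_re]
    rw [Finset.card_erase_of_mem hi]
    have := Finset.card_pos.mpr ⟨i, hi⟩
    obtain ⟨k, hk⟩ := he
    exact ⟨k - 1, by omega⟩
  · by_cases hu : C = Finset.univ
    · -- the volume element is anti-Hermitian, so its trace is imaginary
      have h := hω.conjTranspose C
      rw [hu, cliffordSign_univ m hp, neg_one_smul] at h
      have h1 := congrArg (fun M => (Matrix.trace M).re) h
      simp only [trace_conjTranspose, trace_neg, Complex.neg_re] at h1
      rw [hu]
      have h2 : (star (ω Finset.univ).trace).re = (ω Finset.univ).trace.re := Complex.conj_re _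
      linarith
    · obtain ⟨i, hi⟩ : ∃ i, i ∉ C := by
        by_contra h
        push Not at h
        exact hu (Finset.eq_univ_iff_forall.mpr h)
      rw [hω.trace_eq_zero_of_odd (i := i), Complex.zero_re]
      rwa [Finset.erase_eq_of_notMem hi]

/-- The basis `ω_A` is orthogonal for the real part of the trace form. -/
theorem cliffordEntries_mul_conjTranspose (hω : IsCliffordRep ω) (hp : p = 4 * m + 1)
    (hκ : Fintype.card κ = 2 ^ (2 * m)) :
    cliffordEntries ω * (cliffordEntries ω)ᴴ = (2 : ℂ) ^ (2 * m + 1) • 1 := by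
  ext A B
  have h1 : (cliffordEntries ω * (cliffordEntries ω)ᴴ) A B =
      ((2 * (ω A * (ω B)ᴴ).trace.re : ℝ) : ℂ) := by
    have h2 : (ω A * (ω B)ᴴ).trace = ∑ k, ∑ l, ω A k l * star (ω B k l) := by
      simp [Matrix.trace, Matrix.mul_apply]
    rw [h2, ← Complex.add_conj]
    simp [Matrix.mul_apply, cliffordEntries, Fintype.sum_prod_type, add_comm]
  rw [h1, hω.conjTranspose, Matrix.mul_smul, hω.mul, trace_smul, trace_smul]
  by_cases hAB : A = B
  · subst hAB
    rw [smul_smul, cliffordSign_mul_self, symmDiff_self, Finset.bot_eq_empty, hω.map_empty]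
    rw [one_smul, trace_one, hκ, Complex.natCast_re]
    simp [pow_succ, mul_comm]
  · have h3 : (symmDiff A B).Nonempty := by
      rw [Finset.nonempty_iff_ne_empty, ← Finset.bot_eq_empty, Ne, symmDiff_eq_bot]
      exact hAB
    simp [hω.re_trace_eq_zero hp h3, hAB]

/-- The completeness relation. As `2 ^ p = 2 (2 ^ (2 m))²`, the matrix of entries is square, so it
follows from orthogonality. -/
theorem conjTranspose_mul_cliffordEntries (hω : IsCliffordRep ω) (hp : p = 4 * m + 1)
    (hκ : Fintype.card κ = 2 ^ (2 * m)) :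
    (cliffordEntries ω)ᴴ * cliffordEntries ω = (2 : ℂ) ^ (2 * m + 1) • 1 := by
  have h0 : ((2 : ℂ) ^ (2 * m + 1)) ≠ 0 := pow_ne_zero _ two_ne_zero
  have hcard : Fintype.card (Finset (Fin p)) = Fintype.card (Bool × κ × κ) := by
    simp only [Fintype.card_finset, Fintype.card_fin, Fintype.card_prod, Fintype.card_bool, hκ, hp]
    ring
  have h1 : cliffordEntries ω * (((2 : ℂ) ^ (2 * m + 1))⁻¹ • (cliffordEntries ω)ᴴ) = 1 := by
    rw [Matrix.mul_smul, hω.cliffordEntries_mul_conjTranspose hp hκ, smul_smul,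
      inv_mul_cancel₀ h0, one_smul]
  have h2 := (mul_eq_one_comm_of_card_eq _ _ _ hcard).mp h1
  rw [Matrix.smul_mul] at h2
  rw [← h2, smul_smul, mul_inv_cancel₀ h0, one_smul]

theorem sum_mul_eq_zero (hω : IsCliffordRep ω) (hp : p = 4 * m + 1)
    (hκ : Fintype.card κ = 2 ^ (2 * m)) (i j k l : κ) : ∑ A, ω A i j * ω A k l = 0 := by
  have h := congrFun (congrFun (hω.conjTranspose_mul_cliffordEntries hp hκ) (true, i, j))
    (false, k, l)
  simpa [Matrix.mul_apply, cliffordEntries] using h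

theorem sum_sign_mul (hω : IsCliffordRep ω) (hp : p = 4 * m + 1)
    (hκ : Fintype.card κ = 2 ^ (2 * m)) (i j k l : κ) :
    ∑ A, (cliffordSign A A : ℂ) * (ω A i j * ω A k l) =
      if i = l ∧ j = k then (2 : ℂ) ^ (2 * m + 1) else 0 := by
  have h := congrFun (congrFun (hω.conjTranspose_mul_cliffordEntries hp hκ) (false, j, i))
    (false, k, l)
  have hs : ∀ A, star (ω A j i) = (cliffordSign A A : ℂ) * ω A i j := by
    intro A
    have := congrFun (congrFun (hω.conjTranspose A) i) j
    simpa using this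
  simp only [Matrix.mul_apply, cliffordEntries, conjTranspose_apply, Matrix.of_apply, cond_false,
    hs, mul_assoc] at h
  rw [h]
  simp [Matrix.one_apply, and_comm]

end IsCliffordRep

end CliffordRep

/-! ### The Clifford-symmetric matrices as a Hermitian family -/

section CliffordFamily

open Matrix

variable {m n p : ℕ} {κ : Type*}

theorem sum_cliffordMetric_smul {V : Type*} [AddCommGroup V] [Module ℝ V] (A : Finset (Fin p))
    (i j : Fin n) (f : CliffordIdx p n → V) :
    ∑ b, cliffordMetric (A, i, j) b • f b =
      (1 / 2 : ℝ) • (f (A, i, j) + cliffordSign A A • f (A, j, i)) := by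
  have h : ∀ b, cliffordMetric (A, i, j) b • f b =
      (1 / 2 : ℝ) • ((if b = (A, i, j) then f b else 0) +
        if b = (A, j, i) then cliffordSign A A • f b else 0) := by
    rintro ⟨B, k, l⟩
    simp only [cliffordMetric, Prod.mk.injEq]
    by_cases hAB : A = B
    · subst hAB
      by_cases h1 : i = k <;> by_cases h2 : j = l <;> by_cases h3 : i = l <;>
        by_cases h4 : j = k <;> simp [h1, h2, h3, h4, eq_comm, mul_smul, add_smul]
    · simp [hAB, Ne.symm hAB]
  simp only [h, ← Finset.smul_sum, Finset.sum_add_distrib]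
  simp

theorem mem_fixedPoints_cliffordMetric (x : CliffordIdx p n → ℝ) :
    x ∈ fixedPoints cliffordMetric ↔ x ∈ cliffordSymmetric p n := by
  have h1 : x ∈ fixedPoints cliffordMetric ↔
      ∀ A i j, cliffordSign A A * x (A, j, i) = x (A, i, j) := by
    constructor
    · intro h A i j
      have h2 := h (A, i, j)
      have h3 := sum_cliffordMetric_smul A i j x
      simp only [smul_eq_mul] at h3
      linarith
    · rintro h ⟨A, i, j⟩
      have h3 := sum_cliffordMetric_smul A i j x
      simp only [smul_eq_mul] at h3
      rw [h3, h]
      ring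
  rw [h1]
  constructor
  · intro h A
    ext i j
    simpa [cliffordComponent] using (h A j i).symm
  · intro h A i j
    have := congrFun (congrFun (h A) j) i
    simpa [cliffordComponent] using this.symm

theorem isProjectionForm_cliffordMetric :
    IsProjectionForm (cliffordMetric : CliffordIdx p n → CliffordIdx p n → ℝ) where
  symm := by
    rintro ⟨A, i, j⟩ ⟨B, k, l⟩
    by_cases hAB : A = B
    · subst hAB
      simp only [cliffordMetric, eq_comm, and_comm]
    · simp [cliffordMetric, hAB, Ne.symm hAB]
  idem := by
    rintro ⟨A, i, j⟩ ⟨B, k, l⟩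
    have h := sum_cliffordMetric_smul A i j fun c => cliffordMetric c (B, k, l)
    simp only [smul_eq_mul] at h
    rw [h]
    by_cases hAB : A = B
    · subst hAB
      have := cliffordSign_mul_self A A
      simp only [cliffordMetric, if_true, and_comm (a := j = k), and_comm (a := j = l)]
      linear_combination (1 / 4 * (if i = k ∧ j = l then 1 else 0)) * this
    · simp [cliffordMetric, hAB]

/-- The matrices `E_{ij} ⊗ ω_A`, which span the Clifford-symmetric matrices in the representation
`ω`. -/
noncomputable def cliffordFamily (ω : Finset (Fin p) → Matrix κ κ ℂ) (a : CliffordIdx p n) :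
    Matrix (Fin n × κ) (Fin n × κ) ℂ :=
  Matrix.of fun r s => if a.2 = (r.1, s.1) then ω a.1 r.2 s.2 else 0

theorem pencil_cliffordFamily_apply (ω : Finset (Fin p) → Matrix κ κ ℂ)
    (x : CliffordIdx p n → ℂ) (r s : Fin n × κ) :
    pencil (cliffordFamily ω) x r s = ∑ A, x (A, r.1, s.1) * ω A r.2 s.2 := by
  rw [pencil, Matrix.sum_apply, Fintype.sum_prod_type]
  refine Finset.sum_congr rfl fun A _ => ?_
  simp [cliffordFamily]

variable [Fintype κ] [DecidableEq κ]

/-- The completeness relation of `ω` gives the flip with the factor `½ 2 ^ (2 m + 1)`. -/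
theorem IsCliffordRep.isHermitianFamily {ω : Finset (Fin p) → Matrix κ κ ℂ}
    (hω : IsCliffordRep ω) (hp : p = 4 * m + 1) (hκ : Fintype.card κ = 2 ^ (2 * m)) :
    IsHermitianFamily cliffordMetric (cliffordFamily ω : CliffordIdx p n → _) (2 ^ (2 * m)) where
  proj := isProjectionForm_cliffordMetric
  casimir := by
    rintro ⟨i, i'⟩ ⟨j, j'⟩ ⟨k, k'⟩ ⟨l, l'⟩
    have h1 : ∀ a : CliffordIdx p n, ∑ b, (cliffordMetric a b : ℂ) *
        (cliffordFamily ω a (i, i') (j, j') * cliffordFamily ω b (k, k') (l, l')) =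
        if a.2 = (i, j) then (1 / 2 : ℂ) * (ω a.1 i' j' *
          ((if (i, j) = (k, l) then ω a.1 k' l' else 0) +
            cliffordSign a.1 a.1 * if (j, i) = (k, l) then ω a.1 k' l' else 0)) else 0 := by
      rintro ⟨A, u, v⟩
      have h := sum_cliffordMetric_smul A u v fun b => cliffordFamily ω b (k, k') (l, l')
      simp only [Complex.real_smul] at h
      simp only [mul_left_comm _ (cliffordFamily ω _ _ _), ← Finset.mul_sum, h]
      simp only [cliffordFamily, Matrix.of_apply]
      by_cases h1 : (u, v) = (i, j)
      · obtain ⟨rfl, rfl⟩ := Prod.mk.inj h1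
        simp only [if_true]
        push_cast
        ring
      · simp [h1]
    simp only [h1]
    rw [Fintype.sum_prod_type]
    simp only [Finset.sum_ite_eq', Finset.mem_univ, if_true, ← Finset.mul_sum]
    have h2 := hω.sum_mul_eq_zero hp hκ i' j' k' l'
    have h3 := hω.sum_sign_mul hp hκ i' j' k' l'
    have h4 : ∀ A, ω A i' j' * ((if (i, j) = (k, l) then ω A k' l' else 0) +
        cliffordSign A A * if (j, i) = (k, l) then ω A k' l' else 0) =
        (if (i, j) = (k, l) then 1 else 0) * (ω A i' j' * ω A k' l') +
        (if (j, i) = (k, l) then 1 else 0) *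
          ((cliffordSign A A : ℂ) * (ω A i' j' * ω A k' l')) := by
      intro A
      split_ifs <;> ring
    simp only [h4, Finset.sum_add_distrib, ← Finset.mul_sum, h2, h3, mul_zero, zero_add]
    push_cast
    by_cases h5 : i = l <;> by_cases h6 : j = k <;> by_cases h7 : i' = l' <;>
      by_cases h8 : j' = k' <;> simp [h5, h6, h7, h8, pow_succ]
    ring
  isHermitian := by
    intro x hx
    rw [mem_fixedPoints_cliffordMetric] at hx
    ext r s
    rw [Matrix.conjTranspose_apply, pencil_cliffordFamily_apply, pencil_cliffordFamily_apply,
      star_sum]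
    refine Finset.sum_congr rfl fun A _ => ?_
    have h1 := congrFun (congrFun (hx A) r.1) s.1
    have h2 := congrFun (congrFun (hω.conjTranspose A) r.2) s.2
    simp only [cliffordComponent, transpose_apply, Matrix.of_apply, Matrix.smul_apply,
      smul_eq_mul, conjTranspose_apply, Complex.real_smul] at h1 h2
    rw [star_mul', h1, h2]
    have h3 : (cliffordSign A A : ℂ) * cliffordSign A A = 1 := by
      exact_mod_cast cliffordSign_mul_self A A
    rw [Complex.star_def, Complex.conj_ofReal, Complex.ofReal_mul]
    linear_combination (x (A, r.1, s.1) * ω A r.2 s.2 : ℂ) * h3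

end CliffordFamily

/-! ### The block matrix as a multiple of the representation `ω` -/

section CliffordBlock

open Matrix

variable {m n p : ℕ} {κ : Type*} [Fintype κ] [DecidableEq κ]

theorem Matrix.charpoly_blockDiagonal {o N K : Type*} [Fintype o] [DecidableEq o] [Fintype N]
    [DecidableEq N] [CommRing K] (M : o → Matrix N N K) :
    (blockDiagonal M).charpoly = ∏ k, (M k).charpoly := by
  rw [charpoly, show charmatrix (blockDiagonal M) = blockDiagonal fun k => charmatrix (M k) by
    ext1 ⟨i, k⟩ ⟨j, l⟩
    by_cases hkl : k = l
    · subst hkl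
      by_cases hij : i = j
      · subst hij; simp [blockDiagonal_apply, charmatrix_apply_eq]
      · rw [charmatrix_apply_ne _ _ _ (by simpa using hij)]
        simp [blockDiagonal_apply, charmatrix_apply_ne _ _ _ hij]
    · rw [charmatrix_apply_ne _ _ _ (by simp [hkl])]
      simp [blockDiagonal_apply, hkl]]
  exact det_blockDiagonal _

/-- The entries of `ω` and their conjugates, tensored with the identity of `ℂⁿ`. It intertwines the
block matrix with copies of the matrix in the representation `ω` and of its conjugate. -/
noncomputable def blockIntertwiner (n : ℕ) (ω : Finset (Fin p) → Matrix κ κ ℂ) :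
    Matrix (Finset (Fin p) × Fin n) ((Fin n × κ) × (Bool × κ)) ℂ :=
  Matrix.of fun r s => if r.2 = s.1.1 then cliffordEntries ω r.1 (s.2.1, s.1.2, s.2.2) else 0

namespace IsCliffordRep

variable {ω : Finset (Fin p) → Matrix κ κ ℂ}

theorem blockIntertwiner_mul_conjTranspose (hω : IsCliffordRep ω) (hp : p = 4 * m + 1)
    (hκ : Fintype.card κ = 2 ^ (2 * m)) :
    blockIntertwiner n ω * (blockIntertwiner n ω)ᴴ = (2 : ℂ) ^ (2 * m + 1) • 1 := by
  ext ⟨A, i⟩ ⟨B, j⟩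
  have h := congrFun (congrFun (hω.cliffordEntries_mul_conjTranspose hp hκ) A) B
  simp only [Matrix.mul_apply, Fintype.sum_prod_type, conjTranspose_apply] at h
  have h1 : (blockIntertwiner n ω * (blockIntertwiner n ω)ᴴ) (A, i) (B, j) =
      if i = j then ∑ s : Bool, ∑ k : κ, ∑ l : κ,
        cliffordEntries ω A (s, k, l) * star (cliffordEntries ω B (s, k, l)) else 0 := by
    simp only [Matrix.mul_apply, Fintype.sum_prod_type, conjTranspose_apply, blockIntertwiner,
      Matrix.of_apply]
    rw [Finset.sum_eq_single i]
    · simp only [if_true]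
      rw [Finset.sum_comm]
      split_ifs with hij <;> simp_all [eq_comm]
    · intro k _ hk
      simp [hk.symm]
    · simp
  rw [h1, h]
  by_cases hij : i = j <;> by_cases hAB : A = B <;> simp [hij, hAB]

/-- Column `B` of the block matrix lists the coefficients of `(∑ M^A ω_A) ω_B` in the `ω_A`, so the
representation and its conjugate turn it into left multiplication by `∑ M^A ⊗ ω_A` and by the
conjugate of this matrix. -/
theorem transpose_blockIntertwiner_mul (hω : IsCliffordRep ω) (x : CliffordIdx p n → ℝ) :
    (blockIntertwiner n ω)ᵀ * (cliffordBlock x).map Complex.ofRealHom =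
      blockDiagonal (fun o : Bool × κ =>
        bif o.1 then (pencil (cliffordFamily ω) fun a => (x a : ℂ)).map star
          else pencil (cliffordFamily ω) fun a => (x a : ℂ)) * (blockIntertwiner n ω)ᵀ := by
  -- the product formula for the `ω_A` and for their conjugates
  have hW : ∀ (s : Bool) (A B : Finset (Fin p)) (k l : κ),
      ∑ k', cliffordEntries ω A (s, k, k') * cliffordEntries ω B (s, k', l) =
        (cliffordSign A B : ℂ) * cliffordEntries ω (symmDiff A B) (s, k, l) := by
    intro s A B k l
    have h := congrFun (congrFun (hω.mul A B) k) l
    simp only [Matrix.mul_apply, Matrix.smul_apply, Complex.real_smul] at h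
    cases s
    · simpa [cliffordEntries] using h
    · have h' := congrArg star h
      simpa [cliffordEntries] using h'
  have hH : ∀ (s : Bool) (r t : Fin n × κ),
      (bif s then (pencil (cliffordFamily ω) fun a => (x a : ℂ)).map star
          else pencil (cliffordFamily ω) fun a => (x a : ℂ)) r t =
        ∑ A, (x (A, r.1, t.1) : ℂ) * cliffordEntries ω A (s, r.2, t.2) := by
    intro s r t
    cases s <;> simp [pencil_cliffordFamily_apply, cliffordEntries]
  ext ⟨⟨j, k⟩, s, l⟩ ⟨B, j'⟩
  have hL : ((blockIntertwiner n ω)ᵀ * (cliffordBlock x).map Complex.ofRealHom)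
      ((j, k), s, l) (B, j') = ∑ A, (x (A, j, j') : ℂ) *
        ((cliffordSign A B : ℂ) * cliffordEntries ω (symmDiff A B) (s, k, l)) := by
    simp only [Matrix.mul_apply, Fintype.sum_prod_type, transpose_apply, blockIntertwiner,
      Matrix.of_apply, ite_mul, zero_mul, Finset.sum_ite_eq', Finset.mem_univ, if_true,
      Matrix.map_apply, cliffordBlock, cliffordComponent]
    -- substituting `A ∆ B` for `A`
    rw [← Equiv.sum_comp (Function.Involutive.toPerm (fun A => symmDiff A B)
      fun A => symmDiff_symmDiff_cancel_right B A)]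
    refine Finset.sum_congr rfl fun A _ => ?_
    change cliffordEntries ω (symmDiff A B) (s, k, l) * Complex.ofRealHom
      (cliffordSign (symmDiff (symmDiff A B) B) B * x (symmDiff (symmDiff A B) B, j, j')) = _
    rw [symmDiff_symmDiff_cancel_right B A]
    simp only [Complex.ofRealHom_eq_coe, Complex.ofReal_mul]
    ring
  rw [hL, Matrix.mul_apply, Fintype.sum_prod_type, Fintype.sum_prod_type, Finset.sum_eq_single j']
  · have hR : ∀ k' : κ, ∑ o : Bool × κ, blockDiagonal (fun o : Bool × κ =>
        bif o.1 then (pencil (cliffordFamily ω) fun a => (x a : ℂ)).map star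
          else pencil (cliffordFamily ω) fun a => (x a : ℂ)) ((j, k), s, l) ((j', k'), o) *
        (blockIntertwiner n ω)ᵀ ((j', k'), o) (B, j') =
        (∑ A, (x (A, j, j') : ℂ) * cliffordEntries ω A (s, k, k')) *
          cliffordEntries ω B (s, k', l) := by
      intro k'
      rw [Finset.sum_eq_single (s, l)]
      · rw [blockDiagonal_apply, if_pos rfl, hH]
        simp [blockIntertwiner]
      · intro o _ ho
        rw [blockDiagonal_apply, if_neg ho.symm, zero_mul]
      · simp
    simp only [hR, Finset.sum_mul]
    rw [Finset.sum_comm]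
    refine Finset.sum_congr rfl fun A _ => ?_
    rw [← hW, Finset.mul_sum]
    exact Finset.sum_congr rfl fun k' _ => by ring
  · intro j'' _ hj
    refine Finset.sum_eq_zero fun k' _ => Finset.sum_eq_zero fun o _ => ?_
    simp [blockIntertwiner, hj.symm]
  · simp

/-- The block matrix is similar to the direct sum of `2 ^ (2 m)` copies of the matrix in the
representation `ω` and of its conjugate. -/
theorem charpoly_cliffordBlock (hω : IsCliffordRep ω) (hp : p = 4 * m + 1)
    (hκ : Fintype.card κ = 2 ^ (2 * m)) {x : CliffordIdx p n → ℝ}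
    (hx : (pencil (cliffordFamily ω) fun a => (x a : ℂ)).IsHermitian) :
    (cliffordBlock x).charpoly.map Complex.ofRealHom =
      (pencil (cliffordFamily ω) fun a => (x a : ℂ)).charpoly ^ 2 ^ (2 * m + 1) := by
  have h0 : ((2 : ℂ) ^ (2 * m + 1)) ≠ 0 := pow_ne_zero _ two_ne_zero
  set W := blockIntertwiner n ω with hWdef
  set H := pencil (cliffordFamily ω) fun a => (x a : ℂ) with hH
  have hcard : Fintype.card (Finset (Fin p) × Fin n) =
      Fintype.card ((Fin n × κ) × (Bool × κ)) := by
    simp only [Fintype.card_finset, Fintype.card_fin, Fintype.card_prod, Fintype.card_bool, hκ, hp]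
    ring
  set V : Matrix (Finset (Fin p) × Fin n) ((Fin n × κ) × (Bool × κ)) ℂ :=
    ((2 : ℂ) ^ (2 * m + 1))⁻¹ • W.map star with hV
  have hVW : V * Wᵀ = 1 := by
    have h := congrArg transpose (hω.blockIntertwiner_mul_conjTranspose (n := n) hp hκ)
    rw [transpose_mul, transpose_smul, transpose_one] at h
    rw [hV, Matrix.smul_mul, show W.map star = Wᴴᵀ from rfl, h, smul_smul,
      inv_mul_cancel₀ h0, one_smul]
  have hWV : Wᵀ * V = 1 := (mul_eq_one_comm_of_card_eq _ _ _ hcard).mp hVW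
  have h1 := hω.transpose_blockIntertwiner_mul x
  rw [← hWdef, ← hH] at h1
  set D := blockDiagonal (fun o : Bool × κ => bif o.1 then H.map star else H)
  rw [← Matrix.charpoly_map]
  calc ((cliffordBlock x).map Complex.ofRealHom).charpoly
      = (V * (D * Wᵀ)).charpoly := by rw [← h1, ← Matrix.mul_assoc, hVW, Matrix.one_mul]
    _ = (D * Wᵀ * V).charpoly := by
        rw [charpoly_mul_comm_of_le _ _ hcard.ge, hcard, Nat.sub_self, pow_zero, one_mul]
    _ = D.charpoly := by rw [Matrix.mul_assoc, hWV, Matrix.mul_one]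
    _ = ∏ o : Bool × κ, H.charpoly := by
        rw [charpoly_blockDiagonal]
        refine Finset.prod_congr rfl fun o _ => ?_
        cases o.1
        · rfl
        · have h2 : H.map star = Hᵀ := by
            rw [← conjTranspose_transpose, hx.eq]
          rw [cond_true, h2, charpoly_transpose]
    _ = _ := by
        rw [Finset.prod_const, Finset.card_univ, Fintype.card_prod, Fintype.card_bool, hκ,
          pow_succ' 2 (2 * m)]

/-- The sign in `det (𝓜 - X) = ± det (X - 𝓜)` is trivial, as the size `n 2 ^ p` is even. -/
theorem cliffordPoly_eq_pow (hω : IsCliffordRep ω) (hp : p = 4 * m + 1)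
    (hκ : Fintype.card κ = 2 ^ (2 * m)) {x : CliffordIdx p n → ℝ}
    (hx : x ∈ cliffordSymmetric p n) :
    cliffordPoly x = specializeAt (realPencilPoly (cliffordFamily ω)) x ^ 2 ^ (2 * m + 1) := by
  have hH := (hω.isHermitianFamily (n := n) hp hκ).isHermitian x
    ((mem_fixedPoints_cliffordMetric x).mpr hx)
  have h1 : cliffordPoly x = (cliffordBlock x).charpoly := by
    have hneg : (cliffordBlock x).map Polynomial.C - scalar _ Polynomial.X =
        -charmatrix (cliffordBlock x) := by
      simp [charmatrix]
    rw [cliffordPoly, hneg, det_neg, Even.neg_one_pow, one_mul]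
    · rfl
    · rw [Fintype.card_prod, Fintype.card_finset, Fintype.card_fin, hp, pow_succ]
      exact Even.mul_right (by simp) _
  apply Polynomial.map_injective Complex.ofRealHom Complex.ofReal_injective
  rw [h1, hω.charpoly_cliffordBlock hp hκ hH, Polynomial.map_pow,
    map_ofReal_specializeAt_realPencilPoly hH]

end IsCliffordRep

end CliffordBlock

/-! ### Hermitian matrices -/

section HermitianMatrices

open Matrix

variable {N : ℕ}

theorem sum_hermitianMetric_inl_smul {V : Type*} [AddCommGroup V] [Module ℝ V] (i j : Fin N)
    (f : HermitianIdx N → V) :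
    ∑ b, hermitianMetric (Sum.inl (i, j)) b • f b =
      (1 / 2 : ℝ) • (f (Sum.inl (i, j)) + f (Sum.inl (j, i))) := by
  have h : ∀ b : Fin N × Fin N, hermitianMetric (Sum.inl (i, j)) (Sum.inl b) • f (Sum.inl b) =
      (1 / 2 : ℝ) • ((if b = (i, j) then f (Sum.inl b) else 0) +
        if b = (j, i) then f (Sum.inl b) else 0) := by
    rintro ⟨k, l⟩
    simp only [hermitianMetric, Prod.mk.injEq]
    by_cases h1 : i = k <;> by_cases h2 : j = l <;> by_cases h3 : i = l <;> by_cases h4 : j = k <;>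
      simp [h1, h2, h3, h4, eq_comm, mul_smul, add_smul]
  rw [Fintype.sum_sum_type]
  simp only [h, ← Finset.smul_sum, Finset.sum_add_distrib]
  simp [hermitianMetric]

theorem sum_hermitianMetric_inr_smul {V : Type*} [AddCommGroup V] [Module ℝ V] (i j : Fin N)
    (f : HermitianIdx N → V) :
    ∑ b, hermitianMetric (Sum.inr (i, j)) b • f b =
      (1 / 2 : ℝ) • (f (Sum.inr (i, j)) - f (Sum.inr (j, i))) := by
  have h : ∀ b : Fin N × Fin N, hermitianMetric (Sum.inr (i, j)) (Sum.inr b) • f (Sum.inr b) =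
      (1 / 2 : ℝ) • ((if b = (i, j) then f (Sum.inr b) else 0) -
        if b = (j, i) then f (Sum.inr b) else 0) := by
    rintro ⟨k, l⟩
    simp only [hermitianMetric, Prod.mk.injEq]
    by_cases h1 : i = k <;> by_cases h2 : j = l <;> by_cases h3 : i = l <;> by_cases h4 : j = k <;>
      simp [h1, h2, h3, h4, eq_comm, mul_smul, sub_smul]
  rw [Fintype.sum_sum_type]
  simp only [h, ← Finset.smul_sum, Finset.sum_sub_distrib]
  simp [hermitianMetric]

theorem isProjectionForm_hermitianMetric :
    IsProjectionForm (hermitianMetric : HermitianIdx N → HermitianIdx N → ℝ) where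
  symm := by
    rintro (⟨i, j⟩ | ⟨i, j⟩) (⟨k, l⟩ | ⟨k, l⟩) <;> simp only [hermitianMetric, eq_comm, and_comm]
  idem := by
    rintro (⟨i, j⟩ | ⟨i, j⟩) b
    · have h := sum_hermitianMetric_inl_smul i j fun c => hermitianMetric c b
      simp only [smul_eq_mul] at h
      rw [h]
      rcases b with ⟨k, l⟩ | ⟨k, l⟩
      · simp only [hermitianMetric, and_comm (a := j = k), and_comm (a := j = l)]
        ring
      · simp [hermitianMetric]
    · have h := sum_hermitianMetric_inr_smul i j fun c => hermitianMetric c b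
      simp only [smul_eq_mul] at h
      rw [h]
      rcases b with ⟨k, l⟩ | ⟨k, l⟩
      · simp [hermitianMetric]
      · simp only [hermitianMetric, and_comm (a := j = k), and_comm (a := j = l)]
        ring

/-- The matrices `E_{ij}` and `i E_{ij}`, which span the matrices `M + iA`. -/
noncomputable def hermitianFamily : HermitianIdx N → Matrix (Fin N) (Fin N) ℂ
  | Sum.inl a => Matrix.of fun k l => if a = (k, l) then 1 else 0
  | Sum.inr a => Matrix.of fun k l => if a = (k, l) then Complex.I else 0

theorem pencil_hermitianFamily (x : HermitianIdx N → ℝ) :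
    (pencil hermitianFamily fun a => (x a : ℂ)) = hermitianMatrix x := by
  ext k l
  rw [pencil, Matrix.sum_apply, Fintype.sum_sum_type]
  simp [hermitianFamily, hermitianMatrix]

theorem mem_fixedPoints_hermitianMetric (x : HermitianIdx N → ℝ) :
    x ∈ fixedPoints hermitianMetric ↔ (hermitianMatrix x).IsHermitian := by
  have h1 : x ∈ fixedPoints hermitianMetric ↔ ∀ i j, x (Sum.inl (j, i)) = x (Sum.inl (i, j)) ∧
      -x (Sum.inr (j, i)) = x (Sum.inr (i, j)) := by
    constructor
    · intro h i j
      have h2 := h (Sum.inl (i, j))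
      have h3 := sum_hermitianMetric_inl_smul i j x
      have h4 := h (Sum.inr (i, j))
      have h5 := sum_hermitianMetric_inr_smul i j x
      simp only [smul_eq_mul] at h3 h5
      constructor <;> linarith
    · rintro h (⟨i, j⟩ | ⟨i, j⟩)
      · have h3 := sum_hermitianMetric_inl_smul i j x
        simp only [smul_eq_mul] at h3
        rw [h3, (h i j).1]
        ring
      · have h3 := sum_hermitianMetric_inr_smul i j x
        simp only [smul_eq_mul] at h3
        rw [h3, ← (h i j).2]
        ring
  rw [h1, IsHermitian, ← Matrix.ext_iff]
  refine forall_congr' fun i => forall_congr' fun j => ?_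
  rw [Complex.ext_iff]
  simp [hermitianMatrix]

/-- The contributions of `E_{ij} ⊗ E_{ij}` from the real and the imaginary parts cancel, and those
of `E_{ij} ⊗ E_{ji}` add up to the flip. -/
theorem isHermitianFamily_hermitianFamily :
    IsHermitianFamily hermitianMetric (hermitianFamily : HermitianIdx N → _) 1 where
  proj := isProjectionForm_hermitianMetric
  casimir := by
    intro i j k l
    have h1 : ∀ a : Fin N × Fin N, ∑ b, (hermitianMetric (Sum.inl a) b : ℂ) *
        (hermitianFamily (Sum.inl a) i j * hermitianFamily b k l) =
        if a = (i, j) then (1 / 2 : ℂ) * ((if a = (k, l) then 1 else 0) +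
          if (a.2, a.1) = (k, l) then 1 else 0) else 0 := by
      rintro ⟨u, v⟩
      have h := sum_hermitianMetric_inl_smul u v fun b => hermitianFamily b k l
      simp only [Complex.real_smul] at h
      simp only [mul_left_comm _ (hermitianFamily _ _ _), ← Finset.mul_sum, h]
      by_cases h1 : (u, v) = (i, j)
      · simp [hermitianFamily, h1]
      · simp only [hermitianFamily, Matrix.of_apply, if_neg h1, zero_mul]
    have h2 : ∀ a : Fin N × Fin N, ∑ b, (hermitianMetric (Sum.inr a) b : ℂ) *
        (hermitianFamily (Sum.inr a) i j * hermitianFamily b k l) =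
        if a = (i, j) then -(1 / 2 : ℂ) * ((if a = (k, l) then 1 else 0) -
          if (a.2, a.1) = (k, l) then 1 else 0) else 0 := by
      rintro ⟨u, v⟩
      have h := sum_hermitianMetric_inr_smul u v fun b => hermitianFamily b k l
      simp only [Complex.real_smul] at h
      simp only [mul_left_comm _ (hermitianFamily _ _ _), ← Finset.mul_sum, h]
      by_cases h1 : (u, v) = (i, j)
      · simp only [hermitianFamily, h1, Matrix.of_apply, if_true]
        have hI : ∀ P : Prop, ∀ _ : Decidable P, (if P then Complex.I else 0) =
            Complex.I * if P then 1 else 0 := by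
          intro P _; split_ifs <;> simp
        simp only [hI]
        push_cast
        linear_combination (1 / 2 * ((if (i, j) = (k, l) then 1 else 0) -
          if (v, u) = (k, l) then 1 else 0) : ℂ) * Complex.I_mul_I
      · simp only [hermitianFamily, Matrix.of_apply, if_neg h1, zero_mul]
    rw [Fintype.sum_sum_type]
    simp only [h1, h2, Finset.sum_ite_eq', Finset.mem_univ, if_true, Prod.mk.injEq]
    simp only [and_comm (a := i = l)]
    push_cast
    split_ifs <;> norm_num
  isHermitian := by
    intro x hx
    rw [pencil_hermitianFamily]
    exact (mem_fixedPoints_hermitianMetric x).mp hx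

theorem specializeAt_realPencilPoly_hermitianFamily (x : HermitianIdx N → ℝ) :
    specializeAt (realPencilPoly hermitianFamily) x = hermitianPoly x := by
  ext k
  rw [coeff_specializeAt_realPencilPoly, pencil_hermitianFamily, hermitianPoly]
  simp only [Polynomial.finsetSum_coeff, Polynomial.coeff_monomial, Finset.sum_ite_eq',
    Finset.mem_range]
  split_ifs with h
  · rfl
  · rw [Polynomial.coeff_eq_zero_of_natDegree_lt, Complex.zero_re]
    rw [charpoly_natDegree_eq_dim, Fintype.card_fin]
    omega

end HermitianMatrices

/-! ### The chain rule for powers -/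

section ChainRule

open MvPolynomial

variable {ι : Type*} [Fintype ι] [DecidableEq ι] {g : ι → ι → ℝ}

/-- At a point of the image of the projection, the carré du champ only depends on the restrictions
of the two polynomials to that image. -/
theorem IsProjectionForm.carreDuChamp_congr (hg : IsProjectionForm g) {f f' h h' : MvPolynomial ι ℝ}
    (hf : ∀ x ∈ fixedPoints g, eval x f = eval x f')
    (hh : ∀ x ∈ fixedPoints g, eval x h = eval x h')
    {x : ι → ℝ} (hx : x ∈ fixedPoints g) :
    carreDuChamp (diffusionOp g) (fun y => eval y f) (fun y => eval y h) x =
      carreDuChamp (diffusionOp g) (fun y => eval y f') (fun y => eval y h') x := by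
  have hmul : ∀ u v : MvPolynomial ι ℝ, (fun y => eval y u * eval y v) = fun y => eval y (u * v) :=
    fun u v => by simp
  simp only [carreDuChamp, hmul, diffusionOp_eval]
  rw [hg.polyDiffusion_congr hf hx, hg.polyDiffusion_congr hh hx, hf x hx, hh x hx,
    hg.polyDiffusion_congr (f := f * h) (h := f' * h') (fun y hy => by simp [hf y hy, hh y hy]) hx]

theorem carreDuChamp_eval_pow (hg : ∀ a b, g a b = g b a) (f h : MvPolynomial ι ℝ) (k : ℕ)
    (x : ι → ℝ) :
    carreDuChamp (diffusionOp g) (fun y => eval y (f ^ k)) (fun y => eval y (h ^ k)) x =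
      (k * eval x f ^ (k - 1)) * (k * eval x h ^ (k - 1)) *
        carreDuChamp (diffusionOp g) (fun y => eval y f) (fun y => eval y h) x := by
  rw [carreDuChamp_diffusionOp_eval g hg, carreDuChamp_diffusionOp_eval g hg]
  simp only [Finset.mul_sum, Derivation.leibniz_pow, smul_eq_mul, nsmul_eq_mul, map_mul, map_pow,
    map_natCast]
  exact Finset.sum_congr rfl fun a _ => Finset.sum_congr rfl fun b _ => by ring

theorem diffusionOp_eval_pow (hg : ∀ a b, g a b = g b a) (f : MvPolynomial ι ℝ) (k : ℕ)
    (x : ι → ℝ) :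
    diffusionOp g (fun y => eval y (f ^ (k + 2))) x =
      (k + 2) * eval x f ^ (k + 1) * diffusionOp g (fun y => eval y f) x +
        (k + 2) * (k + 1) * eval x f ^ k *
          carreDuChamp (diffusionOp g) (fun y => eval y f) (fun y => eval y f) x := by
  rw [carreDuChamp_diffusionOp_eval g hg, diffusionOp_eval, diffusionOp_eval, eval_polyDiffusion,
    eval_polyDiffusion]
  simp only [Finset.mul_sum, ← Finset.sum_add_distrib]
  refine Finset.sum_congr rfl fun a _ => Finset.sum_congr rfl fun b _ => ?_
  simp only [Derivation.leibniz_pow, Derivation.leibniz, smul_eq_mul, nsmul_eq_mul, map_mul,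
    map_pow, map_natCast, map_add, Derivation.map_natCast, map_zero]
  push_cast
  ring

end ChainRule

/-! ### The characteristic polynomial of the block matrix -/

section CliffordPoly

open Matrix

variable {p n : ℕ}

/-- `P(X)` for a constant `X`, as a polynomial in the entries of the family. -/
noncomputable def cliffordPolyAt (p n : ℕ) (X : ℝ) : MvPolynomial (CliffordIdx p n) ℝ :=
  (Matrix.of fun r c : Finset (Fin p) × Fin n =>
    MvPolynomial.C (cliffordSign (symmDiff r.1 c.1) c.1) *
      MvPolynomial.X (symmDiff r.1 c.1, r.2, c.2) - if r = c then MvPolynomial.C X else 0).det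

theorem eval_cliffordPoly (X : ℝ) (x : CliffordIdx p n → ℝ) :
    (cliffordPoly x).eval X = MvPolynomial.eval x (cliffordPolyAt p n X) := by
  rw [cliffordPoly, cliffordPolyAt, ← Polynomial.coe_evalRingHom, RingHom.map_det, RingHom.map_det]
  congr 1
  ext r c
  by_cases h : r = c
  · subst h; simp [cliffordBlock, cliffordComponent]
  · simp [cliffordBlock, cliffordComponent, h]

theorem Polynomial.eq_or_eq_neg_of_pow_eq_pow {R Q : Polynomial ℝ} {k : ℕ} (hk : k ≠ 0)
    (h : R ^ k = Q ^ k) : R = Q ∨ R = -Q := by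
  have h1 : (R - Q) * (R + Q) = 0 := by
    refine Polynomial.funext fun t => ?_
    have h2 := congrArg (fun S => |Polynomial.eval t S|) h
    simp only [Polynomial.eval_pow, abs_pow] at h2
    have h3 := (pow_left_inj₀ (abs_nonneg _) (abs_nonneg _) hk).mp h2
    have h4 := sq_eq_sq_iff_abs_eq_abs _ _ |>.mpr h3
    simp only [Polynomial.eval_mul, Polynomial.eval_sub, Polynomial.eval_add, Polynomial.eval_zero]
    linear_combination h4
  rcases mul_eq_zero.mp h1 with h2 | h2
  · exact Or.inl (sub_eq_zero.mp h2)
  · exact Or.inr (eq_neg_of_add_eq_zero_left h2)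

end CliffordPoly

/-! ### The diffusion operator on Clifford-symmetric and Hermitian matrices -/

theorem mainTheorem2 (m n p : ℕ) (hp : p = 4 * m + 1) :
    -- the carré du champ of `P`
    (∀ x ∈ cliffordSymmetric p n, ∀ X Y : ℝ, X ≠ Y →
      carreDuChamp (cliffordLaplacian p n)
          (fun y => (cliffordPoly y).eval X) (fun y => (cliffordPoly y).eval Y) x
        = (2 : ℝ) ^ p / (Y - X) *
          ((cliffordPoly x).derivative.eval X * (cliffordPoly x).eval Y
            - (cliffordPoly x).derivative.eval Y * (cliffordPoly x).eval X)) ∧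
    -- the action of the generator on `P`
    (∀ x ∈ cliffordSymmetric p n, ∀ X : ℝ, (cliffordPoly x).eval X ≠ 0 →
      cliffordLaplacian p n (fun y => (cliffordPoly y).eval X) x / (cliffordPoly x).eval X
        = (2 : ℝ) ^ p *
            (((cliffordPoly x).derivative.eval X) ^ 2 / ((cliffordPoly x).eval X) ^ 2
              - (cliffordPoly x).derivative.derivative.eval X / (cliffordPoly x).eval X)
          - (1 / 2) * (((cliffordPoly x).derivative.eval X) ^ 2 / ((cliffordPoly x).eval X) ^ 2)) ∧
    -- `P = Q ^ a` with `a = 2 ^ (2 m + 1)`, and the action of `L̂ = a 2⁻ᵖ L` on `Q`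
    (∃ Q : Polynomial (MvPolynomial (CliffordIdx p n) ℝ),
      Q.Monic ∧ Q.natDegree = n * 2 ^ (2 * m) ∧
      (∀ x ∈ cliffordSymmetric p n, cliffordPoly x = specializeAt Q x ^ 2 ^ (2 * m + 1)) ∧
      (∀ x ∈ cliffordSymmetric p n, ∀ R : Polynomial ℝ, cliffordPoly x = R ^ 2 ^ (2 * m + 1) →
        R = specializeAt Q x ∨ R = -specializeAt Q x) ∧
      (∀ x ∈ cliffordSymmetric p n, ∀ X : ℝ,
        (2 : ℝ) ^ (2 * m + 1) / (2 : ℝ) ^ p *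
            cliffordLaplacian p n (fun y => (specializeAt Q y).eval X) x
          = -(specializeAt Q x).derivative.derivative.eval X) ∧
      (∀ x ∈ cliffordSymmetric p n, ∀ X Y : ℝ, X ≠ Y →
        carreDuChamp
            (fun f y => (2 : ℝ) ^ (2 * m + 1) / (2 : ℝ) ^ p * cliffordLaplacian p n f y)
            (fun y => (specializeAt Q y).eval X) (fun y => (specializeAt Q y).eval Y) x
          = 1 / (Y - X) *
            ((specializeAt Q x).derivative.eval X * (specializeAt Q x).eval Y
              - (specializeAt Q x).derivative.eval Y * (specializeAt Q x).eval X))) ∧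
    -- the same formulas hold for the characteristic polynomial of Hermitian `N × N` matrices,
    -- with `N = n 2 ^ (2 m)` the degree of `Q`
    (∀ x : HermitianIdx (n * 2 ^ (2 * m)) → ℝ, (hermitianMatrix x).IsHermitian →
      (hermitianPoly x).map Complex.ofRealHom = (hermitianMatrix x).charpoly ∧
      (∀ X : ℝ,
        hermitianLaplacian (n * 2 ^ (2 * m)) (fun y => (hermitianPoly y).eval X) x
          = -(hermitianPoly x).derivative.derivative.eval X) ∧
      (∀ X Y : ℝ, X ≠ Y →
        carreDuChamp (hermitianLaplacian (n * 2 ^ (2 * m)))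
            (fun y => (hermitianPoly y).eval X) (fun y => (hermitianPoly y).eval Y) x
          = 1 / (Y - X) *
            ((hermitianPoly x).derivative.eval X * (hermitianPoly x).eval Y
              - (hermitianPoly x).derivative.eval Y * (hermitianPoly x).eval X))) := by
  obtain ⟨κ, _, _, ω, hκ, hω⟩ := exists_isCliffordRep m p hp
  have hF := hω.isHermitianFamily (n := n) hp hκ
  have hmem : ∀ x : CliffordIdx p n → ℝ,
      x ∈ cliffordSymmetric p n → x ∈ fixedPoints cliffordMetric :=
    fun x hx => (mem_fixedPoints_cliffordMetric x).mpr hx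
  obtain ⟨Q, hQ⟩ : ∃ Q, Q = realPencilPoly (cliffordFamily ω : CliffordIdx p n → _) := ⟨_, rfl⟩
  have hmonic := monic_realPencilPoly (cliffordFamily ω : CliffordIdx p n → _)
  have hdeg := natDegree_realPencilPoly (cliffordFamily ω : CliffordIdx p n → _)
  have hdiff := fun x hx => hF.diffusionOp_eq (hmem x hx)
  have hcarre := fun x hx X Y hXY => hF.carreDuChamp_eq (hmem x hx) (X := X) (Y := Y) hXY
  have hself := fun x hx => hF.carreDuChamp_self (hmem x hx)
  have hP : ∀ x ∈ cliffordSymmetric p n, cliffordPoly x = specializeAt Q x ^ 2 ^ (2 * m + 1) :=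
    fun x hx => hQ ▸ hω.cliffordPoly_eq_pow hp hκ hx
  simp only [← hQ] at hmonic hdeg hdiff hcarre hself
  -- `P(X)` and `Q(X) ^ a` are polynomials in the entries that agree on the symmetric families
  have hPQ : ∀ X : ℝ, ∀ x ∈ fixedPoints (cliffordMetric (p := p) (n := n)),
      MvPolynomial.eval x (cliffordPolyAt p n X) =
        MvPolynomial.eval x (Q.eval (MvPolynomial.C X) ^ 2 ^ (2 * m + 1)) := by
    intro X x hx
    rw [← eval_cliffordPoly, hP x ((mem_fixedPoints_cliffordMetric x).mp hx), Polynomial.eval_pow,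
      eval_specializeAt, map_pow]
  -- with `a = 2 c`, the exponent is `a = k + 2` and `2 ^ p = 2 c ^ 2`
  obtain ⟨k, hk⟩ : ∃ k, 2 ^ (2 * m + 1) = k + 2 :=
    ⟨2 ^ (2 * m + 1) - 2, by
      have : 2 ^ 1 ≤ 2 ^ (2 * m + 1) := Nat.pow_le_pow_right (by norm_num) (by omega)
      omega⟩
  have hkc : (k : ℝ) + 2 = 2 * 2 ^ (2 * m) := by
    have h : ((2 ^ (2 * m + 1) : ℕ) : ℝ) = ((k + 2 : ℕ) : ℝ) := by rw [hk]
    push_cast at h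
    rw [← h, pow_succ]
    ring
  have h2p : (2 : ℝ) ^ p = 2 * (2 ^ (2 * m)) ^ 2 := by
    rw [hp]; ring
  have hc0 : (2 : ℝ) ^ (2 * m) ≠ 0 := pow_ne_zero _ two_ne_zero
  have hscale : (2 : ℝ) ^ (2 * m + 1) / (2 : ℝ) ^ p = 1 / 2 ^ (2 * m) := by
    rw [h2p, pow_succ]; field_simp
  have hder : ∀ x ∈ cliffordSymmetric p n, (cliffordPoly x).derivative =
      Polynomial.C ((k : ℝ) + 2) * specializeAt Q x ^ (k + 1) * (specializeAt Q x).derivative := by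
    intro x hx
    rw [hP x hx, hk, Polynomial.derivative_pow]
    simp
  refine ⟨?_, ?_, ⟨Q, hmonic, ?_, hP, ?_, ?_, ?_⟩, ?_⟩
  · intro x hx X Y hXY
    rw [hder x hx]
    simp only [hP x hx, hk, eval_cliffordPoly, cliffordLaplacian]
    rw [hF.proj.carreDuChamp_congr (hPQ X) (hPQ Y) (hmem x hx),
      carreDuChamp_eval_pow hF.proj.symm]
    simp only [← eval_specializeAt]
    rw [hcarre x hx X Y hXY, hk, h2p]
    simp only [Polynomial.eval_mul, Polynomial.eval_pow, Polynomial.eval_C]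
    push_cast
    rw [hkc]
    have hXY' : Y - X ≠ 0 := sub_ne_zero.mpr hXY.symm
    field_simp
    ring
  · intro x hx X hX
    have hq : (specializeAt Q x).eval X ≠ 0 := by
      intro h
      apply hX
      rw [hP x hx, Polynomial.eval_pow, h, zero_pow (by positivity)]
    have hder2 : (cliffordPoly x).derivative.derivative.eval X =
        ((k : ℝ) + 2) * (((k : ℝ) + 1) * (specializeAt Q x).eval X ^ k *
          (specializeAt Q x).derivative.eval X ^ 2 +
          (specializeAt Q x).eval X ^ (k + 1) *
            (specializeAt Q x).derivative.derivative.eval X) := by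
      rw [hder x hx]
      simp [Polynomial.derivative_mul, Polynomial.derivative_pow]
      ring
    have hL : cliffordLaplacian p n (fun y => (cliffordPoly y).eval X) x =
        diffusionOp cliffordMetric
          (fun y => MvPolynomial.eval y (Q.eval (MvPolynomial.C X) ^ (k + 2))) x := by
      simp only [eval_cliffordPoly, cliffordLaplacian]
      rw [diffusionOp_eval, diffusionOp_eval, hF.proj.polyDiffusion_congr (hPQ X) (hmem x hx), hk]
    rw [hL, diffusionOp_eval_pow hF.proj.symm]
    simp only [← eval_specializeAt]
    rw [hdiff x hx, hself x hx, hder2, hder x hx, hP x hx, hk, h2p]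
    simp only [Polynomial.eval_mul, Polynomial.eval_pow, Polynomial.eval_C]
    rw [show (k : ℝ) + 1 = 2 * 2 ^ (2 * m) - 1 by linarith, hkc]
    simp only [pow_succ]
    field_simp
    ring
  · rw [hdeg, Fintype.card_prod, Fintype.card_fin, hκ]
  · intro x hx R hR
    rw [hP x hx] at hR
    exact Polynomial.eq_or_eq_neg_of_pow_eq_pow (by positivity) hR.symm
  · intro x hx X
    rw [hscale, cliffordLaplacian, hdiff x hx]
    field_simp
  · intro x hx X Y hXY
    rw [hscale, carreDuChamp_const_mul, cliffordLaplacian, hcarre x hx X Y hXY]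
    field_simp
  · intro x hx
    have hG := isHermitianFamily_hermitianFamily (N := n * 2 ^ (2 * m))
    have hx' := (mem_fixedPoints_hermitianMetric x).mpr hx
    simp only [← specializeAt_realPencilPoly_hermitianFamily, hermitianLaplacian]
    refine ⟨?_, fun X => ?_, fun X Y hXY => ?_⟩
    · rw [← pencil_hermitianFamily]
      exact map_ofReal_specializeAt_realPencilPoly (hG.isHermitian x hx')
    · rw [hG.diffusionOp_eq hx', one_mul]
    · rw [hG.carreDuChamp_eq hx' hXY, one_mul]
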